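/- **Model.** Let $\Theta\subset\mathbb R^d$, $\Phi\subset\mathbb R^{p}$, $\Psi=(\Psi_1,\dots,\Psi_k)^T:\Theta\times\Phi\to\mathbb R^k$, and let $\Theta(\phi)=\{\theta\in\Theta:\Psi(\theta,\phi)\le 0\}$ be the identified set, $S_\phi(\nu)=\sup_{\theta\in\Theta(\phi)}\nu^T\theta$ its support function on the unit sphere $\mathbb S$ of $\mathbb R^d$, and $\Xi(\nu,\phi)$ the set of maximisers of $\nu^T\theta$ over $\Theta(\phi)$. For a set $A\subset\Theta$ and $\epsilon\ge0$ put $A^{\epsilon}=\{\theta\in\Theta:d(\theta,A)\le\epsilon\}$ and $A^{-\epsilon}=\{\theta\in A:d(\theta,\Theta\setminus A)\ge\epsilon\}$, with $d(\theta,\emptyset)=\infty$. The sampling distribution of one observation is $P_t$, $t\in\Lambda$ ($\Lambda$ a measurable space, e.g. a set of distributions, or of pairs of $\phi$ and a nuisance parameter); $\phi:\Lambda\to\Phi$ is measurable, $\pi$ is a prior on $\Lambda$, and the posterior given $D_n=(X_1,\dots,X_n)$ is any version of the conditional distribution of $t$ given $D_n$ (a Markov kernel). The data $X_1,X_2,\dots$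 are i.i.d. with law $P_{t_0}$, $\phi_0=\phi(t_0)$; $\to^p$, $\to^d$, $o_p(1)$ and $P_{D_n}$ refer to this sampling distribution. Let $r_n=\sqrt{(\log n)/n}$ and $B_n=\{\phi\in\Phi:\|\phi-\phi_0\|\le r_n\}$. **Assumptions.** 1. $\Psi$ is continuous on $\Theta\times\Phi$, and each $\Psi_i(\cdot,\phi)$, $\phi\in\Phi$, is convex on $\Theta$; $\phi_0$ is in the interior of $\Phi$; $\Theta$ is convex and compact. 2. For all large $n$: on $\Theta\times B_n$ the matrix $\nabla_\phi\Psi$ exists and is continuous; for every $\phi\in B_n$, $\Theta(\phi)$ is nonempty and contained in the interior of $\Theta$, and some $\theta\in\Theta$ has $\Psi_i(\theta,\phi)<0$ for all $i$; for every $i$ with $\Psi_i(\theta_0,\phi_0)=0$ for some $\theta_0\in\Theta(\phi_0)$, $\nabla_\theta\Psi_i(\theta,\phi)$ exists and is continuous on $\{(\theta,\phi):\phi\in B_n,\theta\in\Theta(\phi)\}$. 3. For every $\theta\in\Theta(\phi_0)$ the vectors $\nabla_\theta\Psi_i(\theta,\phi_0)$ with $\Psi_i(\theta,\phi_0)=0$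 are linearly independent. 4. For all large $n$, at least one of the following holds: (i) $\Xi(\nu,\phi)$ is a singleton for all $(\nu,\phi)\in\mathbb S\times B_n$; (ii) each $\Psi_i(\cdot,\phi_0)$ is either strictly convex on $\Theta$ or linear, at least one is linear, and the subvector of linear ones is $\Psi_L(\theta,\phi_0)=A_1\theta+A_2(\phi_0)$ for a matrix $A_1$ and a function $A_2$ on $\Phi$. 5. $\lambda(\nu,\phi)\in[0,\infty)^k$ are Lagrange multipliers: for all large $n$, $S_\phi(\nu)=\sup_{\theta\in\Theta}\{\nu^T\theta-\lambda(\nu,\phi)^T\Psi(\theta,\phi)\}$ for $(\nu,\phi)\in\mathbb S\times B_n$. For all large $n$ there is $K>0$ such that for all $\phi_1,\phi_2\in B_n$ and $\theta_1,\theta_2\in\Theta$: $\sup_\nu\|\lambda(\nu,\phi_1)-\lambda(\nu,\phi_2)\|\le K\|\phi_1-\phi_2\|$, $\sup_{\theta\in\Theta}\|\nabla_\phi\Psi(\theta,\phi_1)-\nabla_\phi\Psi(\theta,\phi_2)\|\le K\|\phi_1-\phi_2\|$ and $\|\nabla_\phi\Psi(\theta_1,\phi_0)-\nabla_\phi\Psi(\theta_2,\phi_0)\|\le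 K\|\theta_1-\theta_2\|$ (Frobenius norm). Moreover, for every compact $W\subset\mathbb S$ such that $\Xi(\nu,\phi_0)$ is a singleton for all $\nu\in W$: if, for all large $n$, $\Xi$ is upper hemicontinuous on $\mathbb S\times B_n$, then there are $\varepsilon_n=O(r_n)$ such that, for all large $n$, $\Xi(\nu,\phi_1)\subset\Xi(\nu,\phi_0)^{\varepsilon_n}$ for all $\nu\in W$, $\phi_1\in B_n$. 6. (Nondegeneracy) $\lambda(\nu,\phi_0)^T\nabla_\phi\Psi(\theta,\phi_0)\ne0$ for some $\nu\in\mathbb S$ and $\theta\in\Xi(\nu,\phi_0)$. 7. For some $C>0$, $P(\|\phi-\phi_0\|\le C\sqrt{(\log n)/n}\mid D_n)\to^p1$. 8. $\mathcal C$ is a collection of one-dimensional submodels $s\mapsto\gamma(s)\in\Lambda$, $\gamma(0)=t_0$, for which $s\mapsto P_{\gamma(s)}$ is differentiable in quadratic mean at $s=0+$, with mean-zero scores $g\in L^2(P_{t_0})$. The function $l=l_{\phi_0}$ is the efficient score and the nonsingular matrix $I_0=E[l\,l^T]$ the efficient information for $\phi$ at $t_0$ relative to $\mathcal C$: the coordinates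 of $l$ lie in the $L^2(P_{t_0})$-closed linear span of the scores, and $\frac{d}{ds}\phi(\gamma(s))|_{s=0+}=E[I_0^{-1}l\,g]$ for every submodel in $\mathcal C$ with score $g$. With $\Delta_n=n^{-1/2}\sum_{i=1}^nI_0^{-1}l(X_i)$, the posterior law of $\sqrt n(\phi-\phi_0)$ satisfies $\|P_{\sqrt n(\phi-\phi_0)|D_n}-\mathcal N(\Delta_n,I_0^{-1})\|_{TV}\to^p0$. 9. The estimator $\hat\phi=\hat\phi(D_n)\in\Phi$ satisfies $\sqrt n(\hat\phi-\phi_0)\to^d\mathcal N(0,I_0^{-1})$. **Conclusion.** Let $\tau\in(0,1)$ and let $q_\tau=q_\tau(D_n)$ be the $(1-\tau)$-quantile of the posterior law of $J(\phi)=\sqrt n\sup_{\nu\in\mathbb S}|S_\phi(\nu)-S_{\hat\phi}(\nu)|$, i.e. $q_\tau=\inf\{c:P(J(\phi)\le c\mid D_n)\ge1-\tau\}$ (with the convention $S_\phi\equiv0$ if $\Theta(\phi)=\emptyset$). Then $$P_{D_n}\big(\Theta(\hat\phi)^{-q_\tau/\sqrt n}\subset\Theta(\phi_0)\subset\Theta(\hat\phi)^{q_\tau/\sqrt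 n}\big)\ \ge\ 1-\tau+o_p(1),$$ meaning that there are measurable $\Delta(D_n)=o_p(1)$ such that the left-hand side, a number depending only on $n$, is at least $1-\tau+\Delta(D_n)$ for every $n$ and every sampling sequence $D_n$. -/

import Mathlib

open MeasureTheory ProbabilityTheory Filter Topology Set Metric
open scoped ENNReal Matrix InnerProductSpace

noncomputable section

/-- `ℝᵐ` with the Euclidean norm. -/
abbrev Euc (m : ℕ) : Type := EuclideanSpace ℝ (Fin m)

/-- The unit sphere of `ℝᵈ`. -/
abbrev USphere (d : ℕ) : Type := Metric.sphere (0 : Euc d) 1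

/-! ### The moment inequality model -/

/-- A moment inequality model: parameter sets `Θ ⊆ ℝᵈ`, `Φ ⊆ ℝᵖ`, and a moment function
`Ψ : Θ × Φ → ℝᵏ`. Values of `Psi` outside `Theta × Phi` are irrelevant. -/
structure MomentModel (d p k : ℕ) where
  /-- the space `Θ` of the structural parameter -/
  Theta : Set (Euc d)
  /-- the space `Φ` of the point identified parameter -/
  Phi : Set (Euc p)
  /-- the moment function `Ψ` -/
  Psi : Euc d → Euc p → Euc k

namespace MomentModel

variable {d p k : ℕ} (M : MomentModel d p k)

/-- The identified set `Θ(φ) = {θ ∈ Θ : Ψ(θ, φ) ≤ 0}`. -/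
def identSet (φ : Euc p) : Set (Euc d) := {θ | θ ∈ M.Theta ∧ ∀ i, M.Psi θ φ i ≤ 0}

/-- The support function `S_φ(ν) = sup {θᵀν : θ ∈ Θ(φ)}`. -/
def supportFn (φ : Euc p) (ν : USphere d) : ℝ :=
  sSup ((fun θ : Euc d => ⟪θ, (ν : Euc d)⟫_ℝ) '' M.identSet φ)

/-- The support set `Ξ(ν, φ)`: the maximisers of `νᵀθ` over `Θ(φ)`. -/
def supportSet (ν : USphere d) (φ : Euc p) : Set (Euc d) :=
  {θ | θ ∈ M.identSet φ ∧ ∀ θ' ∈ M.identSet φ, ⟪(ν : Euc d), θ'⟫_ℝ ≤ ⟪(ν : Euc d), θ⟫_ℝ}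

/-- The `ε`-envelope in `Θ` of a set: `{θ ∈ Θ : d(θ, A) ≤ ε}` (with `d(θ, ∅) = ∞`). -/
def envelope (A : Set (Euc d)) (ε : ℝ) : Set (Euc d) :=
  {θ | θ ∈ M.Theta ∧ infEDist θ A ≤ ENNReal.ofReal ε}

/-- The `ε`-contraction in `Θ` of a set: `{θ ∈ A : d(θ, Θ \ A) ≥ ε}` (with `d(θ, ∅) = ∞`). -/
def contraction (A : Set (Euc d)) (ε : ℝ) : Set (Euc d) :=
  {θ | θ ∈ A ∧ ENNReal.ofReal ε ≤ infEDist θ (M.Theta \ A)}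

/-- `B(φ₀, δ) = {φ ∈ Φ : ‖φ - φ₀‖ ≤ δ}`. -/
def nbhd (φ₀ : Euc p) (δ : ℝ) : Set (Euc p) := {φ | φ ∈ M.Phi ∧ ‖φ - φ₀‖ ≤ δ}

/-- The active constraints `Act(θ, φ)`. -/
def active (θ : Euc d) (φ : Euc p) : Set (Fin k) := {i | M.Psi θ φ i = 0}

/-- The `k × p` matrix `∇_φ Ψ(θ, φ)`. -/
def jac (θ : Euc d) (φ : Euc p) : Matrix (Fin k) (Fin p) ℝ :=
  Matrix.of fun i j => fderiv ℝ (fun φ' => M.Psi θ φ' i) φ (EuclideanSpace.single j 1)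

/-- The vector `∇_θ Ψ_i(θ, φ)`. -/
def gradTheta (i : Fin k) (θ : Euc d) (φ : Euc p) : Euc d :=
  gradient (fun θ' => M.Psi θ' φ i) θ

/-- `l` is a vector of Lagrange multipliers for the programme defining `S_φ(ν)`:
`l ≥ 0` and `S_φ(ν) = sup {νᵀθ - lᵀΨ(θ, φ) : θ ∈ Θ}`. -/
def IsLagrangeMultiplier (ν : USphere d) (φ : Euc p) (l : Euc k) : Prop :=
  (∀ i, 0 ≤ l i) ∧
    IsLUB ((fun θ : Euc d => ⟪(ν : Euc d), θ⟫_ℝ - ∑ i, l i * M.Psi θ φ i) '' M.Theta)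
      (M.supportFn φ ν)

/-- Continuity and convexity of the moment function. -/
structure ContinuousConvex : Prop where
  continuousOn : ContinuousOn (fun z : Euc d × Euc p => M.Psi z.1 z.2) (M.Theta ×ˢ M.Phi)
  convexOn : ∀ φ ∈ M.Phi, ∀ i, ConvexOn ℝ M.Theta fun θ => M.Psi θ φ i

/-- The true value is interior to `Φ`; `Θ` is convex and compact. -/
structure ParameterSpaces (φ₀ : Euc p) : Prop where
  mem_interior : φ₀ ∈ interior M.Phi
  convex : Convex ℝ M.Theta
  compact : IsCompact M.Theta

/-- Regularity on `B(φ₀, δ)`: smoothness in `φ`, nonempty identified sets, Slater's condition,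
interiority, and smoothness in `θ` of every constraint that is active somewhere on `Θ(φ₀)`. -/
structure LocalRegularity (φ₀ : Euc p) (δ : ℝ) : Prop where
  differentiable_phi : ∀ θ ∈ M.Theta, ∀ φ ∈ M.nbhd φ₀ δ, ∀ i,
    DifferentiableAt ℝ (fun φ' => M.Psi θ φ' i) φ
  continuous_jac : ContinuousOn (fun z : Euc d × Euc p => M.jac z.1 z.2)
    (M.Theta ×ˢ M.nbhd φ₀ δ)
  nonempty : ∀ φ ∈ M.nbhd φ₀ δ, (M.identSet φ).Nonempty
  slater : ∀ φ ∈ M.nbhd φ₀ δ, ∃ θ ∈ M.Theta, ∀ i, M.Psi θ φ i < 0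
  subset_interior : ∀ φ ∈ M.nbhd φ₀ δ, M.identSet φ ⊆ interior M.Theta
  differentiable_theta : ∀ i, (∃ θ₀ ∈ M.identSet φ₀, i ∈ M.active θ₀ φ₀) →
    ∀ φ ∈ M.nbhd φ₀ δ, ∀ θ ∈ M.identSet φ, DifferentiableAt ℝ (fun θ' => M.Psi θ' φ i) θ
  continuous_gradTheta : ∀ i, (∃ θ₀ ∈ M.identSet φ₀, i ∈ M.active θ₀ φ₀) →
    ContinuousOn (fun z : Euc d × Euc p => M.gradTheta i z.1 z.2)
      {z | z.2 ∈ M.nbhd φ₀ δ ∧ z.1 ∈ M.identSet z.2}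

/-- The gradients of the active constraints are linearly independent on `Θ(φ₀)`. -/
def IndependentGradients (φ₀ : Euc p) : Prop :=
  ∀ θ ∈ M.identSet φ₀,
    LinearIndependent ℝ fun i : M.active θ φ₀ => M.gradTheta (i : Fin k) θ φ₀

/-- Either all support sets on `B(φ₀, δ)` are singletons, or every constraint at `φ₀` is strictly
convex or linear in `θ`, at least one (those in `L`) being linear, with
`Ψ_L(θ, φ₀) = A₁ θ + A₂(φ₀)`. -/
def SingletonOrLinear (φ₀ : Euc p) (δ : ℝ) : Prop :=
  (∀ ν : USphere d, ∀ φ ∈ M.nbhd φ₀ δ, ∃ θ, M.supportSet ν φ = {θ}) ∨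
  (∃ L : Finset (Fin k), L.Nonempty ∧
    (∀ i, i ∉ L → StrictConvexOn ℝ M.Theta fun θ => M.Psi θ φ₀ i) ∧
    ∃ (A₁ : Matrix L (Fin d) ℝ) (A₂ : Euc p → L → ℝ),
      ∀ θ ∈ M.Theta, ∀ i : L, M.Psi θ φ₀ i = (A₁ *ᵥ θ.ofLp) i + A₂ φ₀ i)

/-- The Frobenius norm of a matrix. -/
def frobNorm {m n : ℕ} (A : Matrix (Fin m) (Fin n) ℝ) : ℝ := √(∑ i, ∑ j, A i j ^ 2)

/-- Lipschitz conditions on the Lagrange multipliers and on `∇_φ Ψ`, on `B(φ₀, δ)`. -/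
def LipschitzConditions (φ₀ : Euc p) (lam : USphere d → Euc p → Euc k) (δ : ℝ) : Prop :=
  ∃ K > 0,
    (∀ φ₁ ∈ M.nbhd φ₀ δ, ∀ φ₂ ∈ M.nbhd φ₀ δ, ∀ ν, ‖lam ν φ₁ - lam ν φ₂‖ ≤ K * ‖φ₁ - φ₂‖) ∧
    (∀ φ₁ ∈ M.nbhd φ₀ δ, ∀ φ₂ ∈ M.nbhd φ₀ δ, ∀ θ ∈ M.Theta,
      frobNorm (M.jac θ φ₁ - M.jac θ φ₂) ≤ K * ‖φ₁ - φ₂‖) ∧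
    (∀ θ₁ ∈ M.Theta, ∀ θ₂ ∈ M.Theta,
      frobNorm (M.jac θ₁ φ₀ - M.jac θ₂ φ₀) ≤ K * ‖θ₁ - θ₂‖)

/-- Along radii `r n`: on every compact set `W` of directions with singleton `Ξ(ν, φ₀)`, if `Ξ` is
upper hemicontinuous on `𝕊 × B(φ₀, r n)`, then `Ξ(ν, φ₁) ⊆ Ξ(ν, φ₀)^ε` for `φ₁ ∈ B(φ₀, r n)` and
some `ε = O(r n)`. -/
def SupportSetRate (φ₀ : Euc p) (r : ℕ → ℝ) : Prop :=
  ∀ W : Set (USphere d), IsCompact W → (∀ ν ∈ W, ∃ θ, M.supportSet ν φ₀ = {θ}) →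
    (∀ᶠ n in atTop, UpperHemicontinuousOn
      (fun z : USphere d × Euc p => M.supportSet z.1 z.2) (univ ×ˢ M.nbhd φ₀ (r n))) →
    ∃ ε : ℕ → ℝ, ε =O[atTop] r ∧
      ∀ᶠ n in atTop, ∀ ν ∈ W, ∀ φ₁ ∈ M.nbhd φ₀ (r n),
        M.supportSet ν φ₁ ⊆ M.envelope (M.supportSet ν φ₀) (ε n)

/-- The first-order term `λ(ν, φ₀)ᵀ ∇_φ Ψ(θ, φ₀)`, `θ ∈ Ξ(ν, φ₀)`, of the support function does
not vanish identically. -/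
def Nondegenerate (φ₀ : Euc p) (lam : USphere d → Euc p → Euc k) : Prop :=
  ∃ ν : USphere d, ∃ θ ∈ M.supportSet ν φ₀, (lam ν φ₀).ofLp ᵥ* M.jac θ φ₀ ≠ 0

end MomentModel

/-! ### The statistical model -/

section Statistics

variable {𝒳 Λ : Type*} [MeasurableSpace 𝒳] [MeasurableSpace Λ]

/-- `post` is (a version of) the posterior of the parameter given `n` i.i.d. observations: the
sampling distribution given `t` is `(P t)ⁿ` and the prior is `π`. -/
def IsPosterior (P : Kernel Λ 𝒳) (π : Measure Λ) (n : ℕ) (post : Kernel (Fin n → 𝒳) Λ) : Prop :=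
  ∀ (A : Set Λ) (B : Set (Fin n → 𝒳)), MeasurableSet A → MeasurableSet B →
    ∫⁻ t, ∫⁻ x in B, post x A ∂(Measure.pi fun _ : Fin n => P t) ∂π
      = ∫⁻ t in A, Measure.pi (fun _ : Fin n => P t) B ∂π

/-- The one-dimensional submodel `s ↦ P (γ s)`, `s ≥ 0`, starting at `P t₀`, is differentiable in
quadratic mean with score `g`. Densities are taken with respect to `P (γ s) + P t₀`. -/
def IsScore (P : Kernel Λ 𝒳) (t₀ : Λ) (γ : ℝ → Λ) (g : Lp ℝ 2 (P t₀)) : Prop :=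
  γ 0 = t₀ ∧ ∫ x, g x ∂(P t₀) = 0 ∧
    Tendsto (fun s : ℝ => ∫⁻ x, ENNReal.ofReal
        (((√((P (γ s)).rnDeriv (P (γ s) + P t₀) x).toReal
            - √((P t₀).rnDeriv (P (γ s) + P t₀) x).toReal) / s
          - 1 / 2 * g x * √((P t₀).rnDeriv (P (γ s) + P t₀) x).toReal) ^ 2)
        ∂(P (γ s) + P t₀)) (𝓝[>] 0) (𝓝 0)

/-- The set of scores of the submodels in `𝒞`. -/
def tangentSet (P : Kernel Λ 𝒳) (t₀ : Λ) (𝒞 : Set (ℝ → Λ)) : Set (Lp ℝ 2 (P t₀)) :=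
  {g | ∃ γ ∈ 𝒞, IsScore P t₀ γ g}

/-- `l` is the efficient score function and `I₀` the (nonsingular) efficient information matrix at
`t₀` for the functional `φ`, relative to the collection `𝒞` of regular submodels: `I₀ = E[l lᵀ]`,
and `I₀⁻¹ l` is the efficient influence function, i.e. it represents the derivative of `φ` along
the submodels of `𝒞` and its coordinates lie in the closed linear span of the tangent set.
(As `I₀` is nonsingular, the coordinates of `l` and of `I₀⁻¹ l` have the same span.) -/
structure IsEfficientScore {p : ℕ} (P : Kernel Λ 𝒳) (φ : Λ → Euc p) (t₀ : Λ) (𝒞 : Set (ℝ → Λ))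
    (l : 𝒳 → Euc p) (I₀ : Matrix (Fin p) (Fin p) ℝ) : Prop where
  regular : ∀ γ ∈ 𝒞, ∃ g, IsScore P t₀ γ g
  memLp : ∀ j, MemLp (fun x => l x j) 2 (P t₀)
  information : ∀ i j, I₀ i j = ∫ x, l x i * l x j ∂(P t₀)
  nonsingular : IsUnit I₀.det
  mem_closure_span : ∀ j,
    (memLp j).toLp _ ∈ (Submodule.span ℝ (tangentSet P t₀ 𝒞)).topologicalClosure
  derivative : ∀ γ ∈ 𝒞, ∀ g, IsScore P t₀ γ g →
    HasDerivWithinAt (fun s => φ (γ s))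
      (WithLp.toLp 2 (I₀⁻¹ *ᵥ fun j => ∫ x, l x j * g x ∂(P t₀))) (Ici 0) 0

/-- The total variation distance `sup_B |μ(B) - ν(B)|` of two probability measures. -/
def tvDist {α : Type*} [MeasurableSpace α] (μ ν : Measure α) : ℝ :=
  ⨆ B : {B : Set α // MeasurableSet B}, |μ.real B - ν.real B|

/-- `Δ_n = n^{-1/2} ∑ I₀⁻¹ l(x_i)`. -/
def scoreAverage {p : ℕ} (l : 𝒳 → Euc p) (I₀ : Matrix (Fin p) (Fin p) ℝ) (n : ℕ)
    (x : Fin n → 𝒳) : Euc p :=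
  (√(n : ℝ))⁻¹ • ∑ i, WithLp.toLp 2 (I₀⁻¹ *ᵥ (l (x i)).ofLp)

/-- The radius `r_n = √(log n / n)`. -/
def logRate (n : ℕ) : ℝ := √(Real.log n / n)

variable {d p k : ℕ}

/-- `√n sup_ν |S_φ₁(ν) - S_φ₂(ν)|`. -/
def MomentModel.scaledSupDist (M : MomentModel d p k) (n : ℕ) (φ₁ φ₂ : Euc p) : ℝ :=
  √(n : ℝ) * ⨆ ν : USphere d, |M.supportFn φ₁ ν - M.supportFn φ₂ ν|

/-- The `1 - τ` quantile `q_τ` of the distribution of `J = √n sup_ν |S_φ(ν) - S_φ̂(ν)|` when the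
parameter has (posterior) distribution `ρ`. -/
def MomentModel.quantile (M : MomentModel d p k) (φ : Λ → Euc p) (n : ℕ) (ρ : Measure Λ)
    (φhat : Euc p) (τ : ℝ) : ℝ :=
  sInf {c : ℝ | 1 - τ ≤ ρ.real {t | M.scaledSupDist n (φ t) φhat ≤ c}}

end Statistics

end

/-! Both inclusions hold as soon as the support functions of Θ(φ₀) and Θ(φ̂) differ uniformly by at
most q_τ/√n (`contraction_subset_and_subset_envelope`). Coverage is thus a comparison between the
law of √n sup|S_φ₀ - S_φ̂| and a posterior quantile.

Geometry (`exists_seminorm`). Let G(h) be the supremum of |⟨λ(ν,φ₀)ᵀ∇_φΨ(θ,φ₀), h⟩| over the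
directions ν whose maximiser θ at φ₀ is unique. Near φ₀, and up to an error ε‖φ₁ - φ₂‖, the seminorm
G(φ₁ - φ₂) bounds sup|S_φ₁ - S_φ₂| from below for all pairs, and from above when one of the two
points is φ₀. For the lower bound, S is strictly differentiable at φ₀ in each such direction, and
finitely many directions suffice by total boundedness. The upper bound involves all maximisers, and
`inner_lagrangeGrad_le` shows that non-unique ones contribute nothing more: on a flat face only
affine constraints carry nonzero multipliers, so the first-order term is convex in θ, and tilting ν
reaches, through unique maximisers, a point where this term is nearly as large.

Statistics. Since √n(φ̂ - φ₀) converges to Z ~ N(0, I₀⁻¹), the sampling law of √n sup|S_φ₀ - S_φ̂|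
is asymptotically dominated by that of G(Z). The posterior of √n(φ - φ₀) is close to N(Δ_n, I₀⁻¹),
so J is asymptotically at least G(Z + b) with the shift b = Δ_n - √n(φ̂ - φ₀). By Anderson's
inequality a shift only removes mass from {G ≤ c}. Hence q_τ is asymptotically no smaller than the 1
- τ quantile of G(Z), however φ̂ is related to Δ_n; this is why coverage is at least, rather than
exactly, 1 - τ. Anderson's inequality is derived from Prékopa-Leindler. The law of G(Z) has no
atoms, because level sets of a nonzero seminorm are null, so two quantile levels just below 1 - τ
leave a positive gap that absorbs all errors. -/

/-! ### Brunn-Minkowski on the line and Prékopa-Leindler for Gaussian measures -/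

section PrekopaLeindler

open scoped Pointwise

/-- The one-dimensional Brunn--Minkowski inequality for compact sets. -/
lemma IsCompact.volume_add_volume_le {A B : Set ℝ} (hA : IsCompact A) (hB : IsCompact B)
    (hAn : A.Nonempty) (hBn : B.Nonempty) : volume A + volume B ≤ volume (A + B) := by
  -- The translates `b + A` and `a + B` both lie in `A + B` and meet only at `a + b`.
  set a := sSup A
  set b := sInf B
  have ha : a ∈ A := hA.sSup_mem hAn
  have hb : b ∈ B := hB.sInf_mem hBn
  have h1 : volume ((fun x => b + x) '' A) = volume A := by
    simp [image_add_left, measure_preimage_add]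
  have h2 : volume ((fun x => a + x) '' B) = volume B := by
    simp [image_add_left, measure_preimage_add]
  have hinter : (fun x => b + x) '' A ∩ (fun x => a + x) '' B ⊆ {a + b} := by
    rintro _ ⟨⟨x, hx, rfl⟩, ⟨y, hy, hxy⟩⟩
    have h3 : x ≤ a := le_csSup hA.bddAbove hx
    have h4 : b ≤ y := csInf_le hB.bddBelow hy
    simp only [mem_singleton_iff] at *
    linarith
  have h0 : volume ((fun x => b + x) '' A ∩ (fun x => a + x) '' B) = 0 :=
    measure_mono_null hinter (by simp)
  have hm : MeasurableSet ((fun x => a + x) '' B) :=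
    (hB.image (by fun_prop)).measurableSet
  have := measure_union_add_inter (μ := volume) ((fun x => b + x) '' A) hm
  rw [h0, add_zero, h1, h2] at this
  rw [← this]
  apply measure_mono
  rintro _ (⟨x, hx, rfl⟩ | ⟨x, hx, rfl⟩)
  · exact ⟨x, hx, b, hb, add_comm _ _⟩
  · exact ⟨a, ha, x, hx, rfl⟩

/-- Inner regularity reduces the claim to compact subsets, whose sum lies in `2 • C`. The points `a`
and `b` are inserted into them because Brunn-Minkowski fails when one set is empty. -/
lemma volume_add_volume_le_two_mul_of_midpoint {A B C : Set ℝ} (hA : MeasurableSet A)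
    (hB : MeasurableSet B) (hAn : A.Nonempty) (hBn : B.Nonempty)
    (h : ∀ x ∈ A, ∀ y ∈ B, (x + y) / 2 ∈ C) : volume A + volume B ≤ 2 * volume C := by
  obtain ⟨a, ha⟩ := hAn
  obtain ⟨b, hb⟩ := hBn
  have e : ∀ U : Set ℝ, MeasurableSet U →
      volume U = ⨆ K, ⨆ (_ : K ⊆ U ∧ IsCompact K), volume K := by
    intro U hU
    rw [hU.measure_eq_iSup_isCompact]
    simp only [iSup_and]
  rw [e A hA, e B hB]
  have key : ∀ K, (K ⊆ A ∧ IsCompact K) → ∀ L, (L ⊆ B ∧ IsCompact L) →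
      volume K + volume L ≤ 2 * volume C := by
    rintro K ⟨hK, hKc⟩ L ⟨hL, hLc⟩
    have h1 : volume (insert a K) + volume (insert b L) ≤ volume (insert a K + insert b L) :=
      (hKc.insert a).volume_add_volume_le (hLc.insert b) ⟨a, by simp⟩ ⟨b, by simp⟩
    have h2 : insert a K + insert b L ⊆ (2 : ℝ) • C := by
      rintro _ ⟨x, hx, y, hy, rfl⟩
      refine ⟨(x + y) / 2, h x ?_ y ?_, by simp; ring⟩
      · rcases hx with rfl | hx; exacts [ha, hK hx]
      · rcases hy with rfl | hy; exacts [hb, hL hy]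
    calc volume K + volume L ≤ volume (insert a K) + volume (insert b L) := by
          gcongr <;> exact subset_insert _ _
      _ ≤ _ := h1
      _ ≤ volume ((2 : ℝ) • C) := measure_mono h2
      _ = 2 * volume C := by
          rw [Measure.addHaar_smul]; simp
  exact ENNReal.biSup_add_biSup_le' ⟨∅, by simp⟩ ⟨∅, by simp⟩ key

lemma ENNReal.four_mul_mul_le_add_sq (a b : ℝ≥0∞) : 4 * (a * b) ≤ (a + b) ^ 2 := by
  by_cases ha : a = ⊤
  · simp [ha]
  by_cases hb : b = ⊤
  · simp [hb]
  lift a to NNReal using ha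
  lift b to NNReal using hb
  have := four_mul_le_sq_add a b
  rw [mul_assoc] at this
  exact_mod_cast this

/-- Layer cake comparison for functions with supremum one. -/
lemma lintegral_add_lintegral_le_of_midpoint {f g h : ℝ → ℝ} (hf : Measurable f)
    (hg : Measurable g) (hh : Measurable h) (hf0 : ∀ x, 0 ≤ f x) (hg0 : ∀ x, 0 ≤ g x)
    (hh0 : ∀ x, 0 ≤ h x) (hf1 : IsLUB (range f) 1) (hg1 : IsLUB (range g) 1)
    (hfg : ∀ x y, f x * g y ≤ h ((x + y) / 2) ^ 2) :
    (∫⁻ x, ENNReal.ofReal (f x)) + ∫⁻ x, ENNReal.ofReal (g x)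
      ≤ 2 * ∫⁻ x, ENNReal.ofReal (h x) := by
  rw [lintegral_eq_lintegral_meas_lt _ (ae_of_all _ hf0) hf.aemeasurable,
    lintegral_eq_lintegral_meas_lt _ (ae_of_all _ hg0) hg.aemeasurable,
    lintegral_eq_lintegral_meas_lt _ (ae_of_all _ hh0) hh.aemeasurable]
  have hanti : ∀ u : ℝ → ℝ, Measurable fun t : ℝ => volume {a | t < u a} := fun u =>
    Antitone.measurable fun s t hst => measure_mono fun x hx => lt_of_le_of_lt hst hx
  rw [← lintegral_add_left (hanti f), ← lintegral_const_mul _ (hanti h)]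
  refine setLIntegral_mono' measurableSet_Ioi fun t (ht : 0 < t) => ?_
  -- The common supremum 1 makes the superlevel sets of `f` and `g` both nonempty for `t < 1` and
  -- both empty for `t ≥ 1`.
  rcases lt_or_ge t 1 with ht1 | ht1
  · obtain ⟨_, ⟨x, rfl⟩, hx⟩ := (lt_isLUB_iff hf1).1 ht1
    obtain ⟨_, ⟨y, rfl⟩, hy⟩ := (lt_isLUB_iff hg1).1 ht1
    refine volume_add_volume_le_two_mul_of_midpoint (measurableSet_lt measurable_const hf)
      (measurableSet_lt measurable_const hg) ⟨x, hx⟩ ⟨y, hy⟩ fun u hu v hv => ?_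
    have h1 : t ^ 2 < h ((u + v) / 2) ^ 2 := by
      refine lt_of_lt_of_le ?_ (hfg u v)
      rw [sq]
      exact mul_lt_mul'' hu hv ht.le ht.le
    exact lt_of_pow_lt_pow_left₀ 2 (hh0 _) h1
  · have h1 : ∀ u : ℝ → ℝ, IsLUB (range u) 1 → {a | t < u a} = ∅ := by
      intro u hu
      ext x
      simpa using (hu.1 ⟨x, rfl⟩).trans ht1
    simp [h1 f hf1, h1 g hg1]

/-- A midpoint version of the one-dimensional Prékopa--Leindler inequality. -/
lemma prekopaLeindler_real {f g h : ℝ → ℝ} (hf : Measurable f)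
    (hg : Measurable g) (hh : Measurable h) (hf0 : ∀ x, 0 ≤ f x) (hg0 : ∀ x, 0 ≤ g x)
    (hh0 : ∀ x, 0 ≤ h x) (hfb : BddAbove (range f)) (hgb : BddAbove (range g))
    (hfg : ∀ x y, f x * g y ≤ h ((x + y) / 2) ^ 2) :
    (∫⁻ x, ENNReal.ofReal (f x)) * ∫⁻ x, ENNReal.ofReal (g x)
      ≤ (∫⁻ x, ENNReal.ofReal (h x)) ^ 2 := by
  set a := ⨆ x, f x with ha
  set b := ⨆ x, g x with hb
  have hfa : ∀ x, f x ≤ a := le_ciSup hfb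
  have hgb' : ∀ x, g x ≤ b := le_ciSup hgb
  rcases (le_trans (hf0 0) (hfa 0)).eq_or_lt with ha0 | ha0
  · have : ∀ x, f x = 0 := fun x => le_antisymm (ha0 ▸ hfa x) (hf0 x)
    simp [this]
  rcases (le_trans (hg0 0) (hgb' 0)).eq_or_lt with hb0 | hb0
  · have : ∀ x, g x = 0 := fun x => le_antisymm (hb0 ▸ hgb' x) (hg0 x)
    simp [this]
  have hlub : ∀ (u : ℝ → ℝ) (c : ℝ), 0 < c → BddAbove (range u) → c = ⨆ x, u x →
      IsLUB (range fun x => u x / c) 1 := by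
    intro u c hc hu hcu
    refine isLUB_iff_le_iff.2 fun y => ?_
    have h1 := isLUB_iff_le_iff.1 (hcu ▸ isLUB_ciSup hu : IsLUB (range u) c) (y * c)
    have h2 : 1 ≤ y ↔ c ≤ y * c := by
      rw [le_mul_iff_one_le_left hc]
    rw [h2, h1]
    simp only [mem_upperBounds, forall_mem_range, div_le_iff₀ hc]
  -- Dividing `f` and `g` by their suprema and `h` by the geometric mean of these preserves the
  -- midpoint hypothesis.
  set s := √(a * b) with hs
  have hs0 : 0 < s := Real.sqrt_pos.2 (by positivity)
  have hss : s ^ 2 = a * b := Real.sq_sqrt (by positivity)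
  have key := lintegral_add_lintegral_le_of_midpoint (f := fun x => f x / a)
    (g := fun x => g x / b) (h := fun x => h x / s) (by fun_prop) (by fun_prop) (by fun_prop)
    (fun x => div_nonneg (hf0 x) ha0.le) (fun x => div_nonneg (hg0 x) hb0.le)
    (fun x => div_nonneg (hh0 x) hs0.le) (hlub f a ha0 hfb ha) (hlub g b hb0 hgb hb)
    (fun x y => by
      rw [div_pow, hss, div_mul_div_comm]
      exact div_le_div_of_nonneg_right (hfg x y) (by positivity))
  have hscale : ∀ (u : ℝ → ℝ) (c : ℝ), Measurable u → 0 < c →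
      ∫⁻ x, ENNReal.ofReal (u x)
        = ENNReal.ofReal c * ∫⁻ x, ENNReal.ofReal (u x / c) := by
    intro u c hu hc
    rw [← lintegral_const_mul _ (by fun_prop)]
    refine lintegral_congr fun x => ?_
    rw [← ENNReal.ofReal_mul hc.le, mul_div_cancel₀ _ hc.ne']
  rw [hscale f a hf ha0, hscale g b hg hb0, hscale h s hh hs0]
  set F := ∫⁻ x, ENNReal.ofReal (f x / a)
  set G := ∫⁻ x, ENNReal.ofReal (g x / b)
  set H := ∫⁻ x, ENNReal.ofReal (h x / s)
  -- The additive inequality `F + G ≤ 2 * H` becomes multiplicative by the arithmetic-geometric mean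
  -- inequality.
  have h1 : F * G ≤ H ^ 2 := by
    have h2 : 4 * (F * G) ≤ 4 * H ^ 2 :=
      calc 4 * (F * G) ≤ (F + G) ^ 2 := ENNReal.four_mul_mul_le_add_sq F G
        _ ≤ (2 * H) ^ 2 := by gcongr
        _ = 4 * H ^ 2 := by ring
    exact (ENNReal.mul_le_mul_iff_right (by norm_num) (by norm_num)).1 h2
  calc ENNReal.ofReal a * F * (ENNReal.ofReal b * G)
      = ENNReal.ofReal (a * b) * (F * G) := by rw [ENNReal.ofReal_mul ha0.le]; ring
    _ ≤ ENNReal.ofReal (a * b) * H ^ 2 := by gcongr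
    _ = (ENNReal.ofReal s * H) ^ 2 := by
        rw [mul_pow, ← ENNReal.ofReal_pow hs0.le, hss]

/-- The Prékopa--Leindler inequality for the standard Gaussian measure on the line. -/
lemma prekopaLeindler_gaussianReal {f g h : ℝ → ℝ≥0∞} (hf : Measurable f)
    (hg : Measurable g) (hh : Measurable h) (hf1 : ∀ x, f x ≤ 1) (hg1 : ∀ x, g x ≤ 1)
    (hh1 : ∀ x, h x ≤ 1) (hfg : ∀ x y, f x * g y ≤ h ((x + y) / 2) ^ 2) :
    (∫⁻ x, f x ∂gaussianReal 0 1) * ∫⁻ x, g x ∂gaussianReal 0 1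
      ≤ (∫⁻ x, h x ∂gaussianReal 0 1) ^ 2 := by
  have hint : ∀ u : ℝ → ℝ≥0∞, Measurable u → (∀ x, u x ≤ 1) → ∫⁻ x, u x ∂gaussianReal 0 1
      = ∫⁻ x, ENNReal.ofReal (gaussianPDFReal 0 1 x * (u x).toReal) := by
    intro u hu hu1
    rw [gaussianReal_of_var_ne_zero _ one_ne_zero, lintegral_withDensity_eq_lintegral_mul _
      (measurable_gaussianPDF 0 1) hu]
    refine lintegral_congr fun x => ?_
    rw [ENNReal.ofReal_mul (gaussianPDFReal_nonneg _ _ _),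
      ENNReal.ofReal_toReal (ne_top_of_le_ne_top ENNReal.one_ne_top (hu1 x))]
    rfl
  rw [hint f hf hf1, hint g hg hg1, hint h hh hh1]
  have hle : ∀ u : ℝ → ℝ≥0∞, (∀ x, u x ≤ 1) → ∀ x, (u x).toReal ≤ 1 := fun u hu x =>
    ENNReal.toReal_le_of_le_ofReal zero_le_one (by simpa using hu x)
  have hpdf : ∀ x, gaussianPDFReal 0 1 x ≤ (√(2 * Real.pi * 1))⁻¹ := fun x => by
    rw [gaussianPDFReal]
    refine mul_le_of_le_one_right (by positivity) (Real.exp_le_one_iff.2 ?_)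
    simp only [NNReal.coe_one]
    have := sq_nonneg (x - 0)
    linarith
  have hbdd : ∀ u : ℝ → ℝ≥0∞, (∀ x, u x ≤ 1) →
      BddAbove (range fun x => gaussianPDFReal 0 1 x * (u x).toReal) := by
    intro u hu
    refine ⟨(√(2 * Real.pi * 1))⁻¹ * 1, ?_⟩
    rintro _ ⟨x, rfl⟩
    exact mul_le_mul (hpdf x) (hle u hu x) ENNReal.toReal_nonneg (by positivity)
  have hmeas := measurable_gaussianPDFReal 0 1
  refine prekopaLeindler_real (hmeas.mul hf.ennreal_toReal) (hmeas.mul hg.ennreal_toReal)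
    (hmeas.mul hh.ennreal_toReal) ?_ ?_ ?_ (hbdd f hf1) (hbdd g hg1) fun x y => ?_
  · exact fun x => mul_nonneg (gaussianPDFReal_nonneg _ _ _) ENNReal.toReal_nonneg
  · exact fun x => mul_nonneg (gaussianPDFReal_nonneg _ _ _) ENNReal.toReal_nonneg
  · exact fun x => mul_nonneg (gaussianPDFReal_nonneg _ _ _) ENNReal.toReal_nonneg
  -- The normal density is log-concave, so it satisfies the midpoint inequality itself and can be
  -- absorbed into the three functions.
  · have h1 : gaussianPDFReal 0 1 x * gaussianPDFReal 0 1 y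
        ≤ gaussianPDFReal 0 1 ((x + y) / 2) ^ 2 := by
      simp only [gaussianPDFReal, NNReal.coe_one]
      rw [mul_pow, ← Real.exp_nat_mul, mul_mul_mul_comm, ← Real.exp_add, ← sq]
      refine mul_le_mul_of_nonneg_left (Real.exp_le_exp.2 ?_) (by positivity)
      push_cast
      nlinarith [sq_nonneg (x - y)]
    have h2 : (f x).toReal * (g y).toReal ≤ (h ((x + y) / 2)).toReal ^ 2 := by
      rw [← ENNReal.toReal_mul, ← ENNReal.toReal_pow]
      exact ENNReal.toReal_mono (ENNReal.pow_ne_top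
        (ne_top_of_le_ne_top ENNReal.one_ne_top (hh1 _))) (hfg x y)
    rw [mul_mul_mul_comm, mul_pow]
    exact mul_le_mul h1 h2 (by positivity) (by positivity)

/-- The Prékopa--Leindler inequality for the standard Gaussian measure on `ℝⁿ`. -/
lemma prekopaLeindler_pi_gaussianReal : ∀ (n : ℕ) {f g h : (Fin n → ℝ) → ℝ≥0∞},
    Measurable f → Measurable g → Measurable h → (∀ x, f x ≤ 1) → (∀ x, g x ≤ 1) →
    (∀ x, h x ≤ 1) → (∀ x y, f x * g y ≤ h (fun i => (x i + y i) / 2) ^ 2) →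
    (∫⁻ x, f x ∂Measure.pi fun _ => gaussianReal 0 1)
        * (∫⁻ x, g x ∂Measure.pi fun _ => gaussianReal 0 1)
      ≤ (∫⁻ x, h x ∂Measure.pi fun _ => gaussianReal 0 1) ^ 2
  | 0, f, g, h, hf, hg, hh, hf1, hg1, hh1, hfg => by
    have : ∀ u : (Fin 0 → ℝ) → ℝ≥0∞,
        ∫⁻ x, u x ∂Measure.pi (fun _ : Fin 0 => gaussianReal 0 1) = u default := fun u => by
      rw [Measure.pi_of_empty _ default, lintegral_dirac]
    rw [this, this, this]
    convert hfg default default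
  | n + 1, f, g, h, hf, hg, hh, hf1, hg1, hh1, hfg => by
    have hcons : Measurable fun z : ℝ × (Fin n → ℝ) => (Fin.cons z.1 z.2 : Fin (n + 1) → ℝ) := by
      refine measurable_pi_lambda _ fun i => ?_
      refine Fin.cases ?_ (fun j => ?_) i
      · simpa using measurable_fst
      · simpa using measurable_pi_iff.1 measurable_snd j
    have hint : ∀ u : (Fin (n + 1) → ℝ) → ℝ≥0∞, Measurable u →
        ∫⁻ x, u x ∂Measure.pi (fun _ : Fin (n + 1) => gaussianReal 0 1)
          = ∫⁻ a, ∫⁻ z, u (Fin.cons a z) ∂Measure.pi (fun _ : Fin n => gaussianReal 0 1)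
            ∂gaussianReal 0 1 := by
      intro u hu
      have hmp := (measurePreserving_piFinSuccAbove
        (fun _ : Fin (n + 1) => gaussianReal 0 1) 0).symm
      rw [← hmp.lintegral_comp hu, lintegral_prod]
      · refine lintegral_congr fun a => lintegral_congr fun z => ?_
        congr 1
        ext i
        refine Fin.cases ?_ (fun j => ?_) i <;> simp [MeasurableEquiv.piFinSuccAbove]
      · exact (hu.comp hmp.measurable).aemeasurable
    have hmeas : ∀ u : (Fin (n + 1) → ℝ) → ℝ≥0∞, Measurable u → Measurable fun a =>
        ∫⁻ z, u (Fin.cons a z) ∂Measure.pi (fun _ : Fin n => gaussianReal 0 1) := fun u hu =>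
      (hu.comp hcons).lintegral_prod_right'
    have hone : ∀ u : (Fin (n + 1) → ℝ) → ℝ≥0∞, (∀ x, u x ≤ 1) → ∀ a,
        ∫⁻ z, u (Fin.cons a z) ∂Measure.pi (fun _ : Fin n => gaussianReal 0 1) ≤ 1 := by
      intro u hu a
      exact (lintegral_mono fun z => hu _).trans (by simp)
    have hm1 : ∀ (u : (Fin (n + 1) → ℝ) → ℝ≥0∞) (a : ℝ), Measurable u →
        Measurable fun z : Fin n → ℝ => u (Fin.cons a z) := fun u a hu =>
      hu.comp (hcons.comp measurable_prodMk_left)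
    rw [hint f hf, hint g hg, hint h hh]
    -- The integrals over the last `n` coordinates satisfy the one-dimensional midpoint hypothesis
    -- by the `n`-dimensional inequality.
    refine prekopaLeindler_gaussianReal (hmeas f hf) (hmeas g hg) (hmeas h hh) (hone f hf1)
      (hone g hg1) (hone h hh1) fun a b => ?_
    refine prekopaLeindler_pi_gaussianReal n (hm1 f a hf) (hm1 g b hg) (hm1 h _ hh)
      (fun _ => hf1 _) (fun _ => hg1 _) (fun _ => hh1 _) fun x y => ?_
    convert hfg (Fin.cons a x) (Fin.cons b y) using 3
    ext i
    refine Fin.cases ?_ (fun j => ?_) i <;> simp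

end PrekopaLeindler

/-! ### Anderson's inequality -/

section Anderson

open scoped MatrixOrder

variable {m : ℕ}

lemma multivariateGaussian_eq_map_pi (a : Euc m) (S : Matrix (Fin m) (Fin m) ℝ) :
    multivariateGaussian a S = (Measure.pi fun _ : Fin m => gaussianReal 0 1).map
      fun z => a + Matrix.toEuclideanCLM (𝕜 := ℝ) (CFC.sqrt S) (WithLp.toLp 2 z) := by
  rw [multivariateGaussian, ← map_pi_eq_stdGaussian, Measure.map_map (by fun_prop) (by fun_prop)]
  rfl

lemma multivariateGaussian_map_neg (a : Euc m) (S : Matrix (Fin m) (Fin m) ℝ) :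
    (multivariateGaussian a S).map (fun x => -x) = multivariateGaussian (-a) S := by
  rw [multivariateGaussian, Measure.map_map (by fun_prop) (by fun_prop)]
  conv_rhs => rw [multivariateGaussian, ← stdGaussian_map (LinearIsometryEquiv.neg ℝ),
    Measure.map_map (by fun_prop) (by fun_prop)]
  congr 1
  ext x : 1
  simp
  abel

/-- Anderson's inequality: shifting a centred Gaussian measure does not increase the mass of a
symmetric convex set. -/
lemma multivariateGaussian_apply_le_of_convex (a : Euc m) (S : Matrix (Fin m) (Fin m) ℝ)
    {K : Set (Euc m)} (hK : MeasurableSet K) (hconv : Convex ℝ K) (hsymm : ∀ x ∈ K, -x ∈ K) :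
    multivariateGaussian a S K ≤ multivariateGaussian 0 S K := by
  set T := Matrix.toEuclideanCLM (𝕜 := ℝ) (CFC.sqrt S)
  have hT : ∀ b : Euc m, Measurable fun z : Fin m → ℝ => b + T (WithLp.toLp 2 z) := fun b => by
    fun_prop
  have hmass : ∀ b : Euc m, multivariateGaussian b S K
      = ∫⁻ z, indicator ((fun z : Fin m → ℝ => b + T (WithLp.toLp 2 z)) ⁻¹' K) 1 z
        ∂Measure.pi fun _ => gaussianReal 0 1 := by
    intro b
    rw [lintegral_indicator_one ((hT b) hK), multivariateGaussian_eq_map_pi,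
      Measure.map_apply (hT b) hK]
  have hneg : multivariateGaussian (-a) S K = multivariateGaussian a S K := by
    rw [← multivariateGaussian_map_neg, Measure.map_apply measurable_neg hK]
    congr 1
    ext x
    exact ⟨fun hx => by simpa using hsymm _ hx, fun hx => hsymm x hx⟩
  have hmi : ∀ b : Euc m, Measurable (indicator
      ((fun z : Fin m → ℝ => b + T (WithLp.toLp 2 z)) ⁻¹' K) (1 : (Fin m → ℝ) → ℝ≥0∞)) :=
    fun b => measurable_one.indicator ((hT b) hK)
  have hle : ∀ (s : Set (Fin m → ℝ)) x, s.indicator (1 : (Fin m → ℝ) → ℝ≥0∞) x ≤ 1 := fun s x =>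
    indicator_le_self' (fun _ _ => zero_le) x
  -- Opposite shifts cancel at the midpoint, and `K` is convex, so the masses satisfy γ_a(K)
  -- γ_{-a}(K) ≤ γ_0(K)². By symmetry of `K` the two factors on the left are equal.
  have key := prekopaLeindler_pi_gaussianReal m (hmi a) (hmi (-a)) (hmi 0) (hle _) (hle _) (hle _)
    fun x y => by
      by_cases hx : a + T (WithLp.toLp 2 x) ∈ K
      · by_cases hy : -a + T (WithLp.toLp 2 y) ∈ K
        · have hxy : (0 : Euc m) + T (WithLp.toLp 2 fun i => (x i + y i) / 2) ∈ K := by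
            have h1 := hconv hx hy (a := 1 / 2) (b := 1 / 2) (by norm_num) (by norm_num)
              (by norm_num)
            convert h1 using 1
            have h2 : (WithLp.toLp 2 fun i => (x i + y i) / 2 : Euc m)
                = (1 / 2 : ℝ) • WithLp.toLp 2 x + (1 / 2 : ℝ) • WithLp.toLp 2 y := by
              ext i
              simp
              ring
            rw [h2, map_add, map_smul, map_smul]
            module
          rw [indicator_of_mem (by exact hx), indicator_of_mem (by exact hy),
            indicator_of_mem (by exact hxy)]
          simp
        · rw [indicator_of_notMem (s := _ ⁻¹' K) (a := y) (by exact hy)]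
          simp
      · rw [indicator_of_notMem (s := _ ⁻¹' K) (a := x) (by exact hx)]
        simp
  rw [← hmass, ← hmass, ← hmass, hneg, ← sq] at key
  exact (ENNReal.pow_le_pow_left_iff (by norm_num)).1 key

end Anderson

/-! ### Distribution of a seminorm under a Gaussian law -/

section GaussianSeminorm

open scoped MatrixOrder

variable {m : ℕ}

lemma pi_gaussianReal_absolutelyContinuous : ∀ n : ℕ,
    Measure.pi (fun _ : Fin n => gaussianReal 0 1) ≪ (volume : Measure (Fin n → ℝ))
  | 0 => by
    rw [volume_pi, Measure.pi_of_empty _ default, Measure.pi_of_empty _ default]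
  | n + 1 => by
    have h1 := (measurePreserving_piFinSuccAbove (fun _ : Fin (n + 1) => gaussianReal 0 1) 0).symm
    have h2 := (volume_preserving_piFinSuccAbove (fun _ : Fin (n + 1) => ℝ) 0).symm
    rw [← h1.map_eq, ← h2.map_eq]
    refine Measure.AbsolutelyContinuous.map ?_ h1.measurable
    exact (gaussianReal_absolutelyContinuous 0 one_ne_zero).prod
      (pi_gaussianReal_absolutelyContinuous n)

/-- The law is the image of the standard Gaussian under an affine map, invertible because the square
root of a positive definite matrix is; such maps pull null sets back to null sets. -/
lemma multivariateGaussian_absolutelyContinuous (a : Euc m) {S : Matrix (Fin m) (Fin m) ℝ}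
    (hS : S.PosDef) : multivariateGaussian a S ≪ (volume : Measure (Euc m)) := by
  set T := Matrix.toEuclideanCLM (𝕜 := ℝ) (CFC.sqrt S)
  have hT : IsUnit T := by
    refine IsUnit.map _ ?_
    exact (CFC.isUnit_sqrt_iff S hS.posSemidef.nonneg).2 hS.isUnit
  have hdet : T.det ≠ 0 := by
    have h1 : IsUnit (LinearMap.det (T : Euc m →ₗ[ℝ] Euc m)) := by
      have := hT.map (ContinuousLinearMap.toLinearMapRingHom (R₁ := ℝ) (M₁ := Euc m))
      exact LinearMap.isUnit_iff_isUnit_det _ |>.1 this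
    exact h1.ne_zero
  have h2 := Measure.ContinuousLinearMap.quasiMeasurePreserving (volume : Measure (Euc m)) T hdet
  have h3 : stdGaussian (Euc m) ≪ (volume : Measure (Euc m)) := by
    rw [← map_pi_eq_stdGaussian, ← (PiLp.volume_preserving_toLp (Fin m)).map_eq]
    exact (pi_gaussianReal_absolutelyContinuous m).map
      (PiLp.volume_preserving_toLp (Fin m)).measurable
  have h4 := (measurePreserving_add_left (volume : Measure (Euc m)) a).quasiMeasurePreserving
  have h5 := h4.comp h2
  exact (h3.map h5.measurable).trans h5.absolutelyContinuous

/-- A level set lies in the frontier of the convex sublevel set, and frontiers of convex sets are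
Lebesgue null. -/
lemma Seminorm.volume_level_eq_zero (G : Seminorm ℝ (Euc m)) (hG : ∃ u, G u ≠ 0) (c : ℝ) :
    (volume : Measure (Euc m)) {x | G x = c} = 0 := by
  have hconv : Convex ℝ {x | G x ≤ c} := by
    have := G.convexOn.convex_le c
    simpa using this
  refine measure_mono_null (fun x (hx : G x = c) => ?_) (hconv.addHaar_frontier volume)
  refine ⟨subset_closure hx.le, fun hint => ?_⟩
  obtain ⟨u, hu⟩ := hG
  have hu0 : 0 < G u := lt_of_le_of_ne (apply_nonneg G u) (Ne.symm hu)
  -- A direction leaving the sublevel set at once: `x` itself when `G x > 0`, and otherwise any `u`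
  -- with `G u ≠ 0`.
  obtain ⟨v, hv⟩ : ∃ v, ∀ t : ℝ, 0 < t → c < G (x + t • v) := by
    rcases (apply_nonneg G x).eq_or_lt with h0 | h0
    · refine ⟨u, fun t ht => ?_⟩
      have h1 : G (t • u) ≤ G (x + t • u) + G x := by
        simpa using map_sub_le_add G (x + t • u) x
      rw [map_smul_eq_mul, Real.norm_of_nonneg ht.le] at h1
      have := mul_pos ht hu0
      linarith
    · refine ⟨x, fun t ht => ?_⟩
      have h1 : x + t • x = (1 + t) • x := by module
      rw [h1, map_smul_eq_mul, Real.norm_of_nonneg (by linarith)]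
      nlinarith
  have hcont : Continuous fun t : ℝ => x + t • v := by fun_prop
  have h2 : ∀ᶠ t : ℝ in 𝓝 0, x + t • v ∈ {x | G x ≤ c} := by
    refine hcont.continuousAt.eventually (p := fun y => y ∈ {x | G x ≤ c}) ?_
    simp only [zero_smul, add_zero]
    exact mem_interior_iff_mem_nhds.1 hint
  have h3 : ∀ᶠ t : ℝ in 𝓝[>] 0, x + t • v ∈ {x | G x ≤ c} := h2.filter_mono nhdsWithin_le_nhds
  obtain ⟨t, ht1, ht2⟩ := (h3.and self_mem_nhdsWithin).exists
  exact absurd ht1 (not_le.2 (hv t ht2))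

/-- The distribution function of a nonzero seminorm under a nondegenerate Gaussian law takes every
value in `(0, 1)`. -/
lemma exists_multivariateGaussian_seminorm_le_eq {S : Matrix (Fin m) (Fin m) ℝ}
    (hS : S.PosDef) (G : Seminorm ℝ (Euc m)) (hGc : Continuous G) (hG : ∃ u, G u ≠ 0)
    {v : ℝ} (hv : v ∈ Ioo (0 : ℝ) 1) :
    ∃ c, (multivariateGaussian 0 S).real {x | G x ≤ c} = v := by
  set μ := (multivariateGaussian 0 S).map G with hμ
  have : IsProbabilityMeasure μ := Measure.isProbabilityMeasure_map hGc.measurable.aemeasurable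
  have hcdf : ∀ c, cdf μ c = (multivariateGaussian 0 S).real {x | G x ≤ c} := by
    intro c
    rw [cdf_eq_real, measureReal_def, hμ, Measure.map_apply hGc.measurable measurableSet_Iic]
    rfl
  have hcont : Continuous (cdf μ) := by
    refine continuous_iff_continuousAt.2 fun c => ?_
    rw [(monotone_cdf μ).continuousAt_iff_leftLim_eq_rightLim, StieltjesFunction.rightLim_eq]
    have h1 : (cdf μ).measure {c} = 0 := by
      rw [measure_cdf, hμ, Measure.map_apply hGc.measurable (measurableSet_singleton c)]
      exact multivariateGaussian_absolutelyContinuous 0 hS (G.volume_level_eq_zero hG c)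
    rw [StieltjesFunction.measure_singleton, ENNReal.ofReal_eq_zero] at h1
    exact le_antisymm ((monotone_cdf μ).leftLim_le le_rfl) (by linarith)
  obtain ⟨c, hc⟩ := mem_range_of_exists_le_of_exists_ge hcont
    ((tendsto_cdf_atBot μ).eventually_le_const hv.1).exists
    ((tendsto_cdf_atTop μ).eventually_const_le hv.2).exists
  exact ⟨c, by rw [← hcdf, hc]⟩

lemma multivariateGaussian_eq_map_add (a : Euc m) (S : Matrix (Fin m) (Fin m) ℝ) :
    multivariateGaussian a S = (multivariateGaussian 0 S).map fun x => a + x := by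
  rw [multivariateGaussian, multivariateGaussian, Measure.map_map (by fun_prop) (by fun_prop)]
  congr 1
  ext x : 1
  simp

/-- Translation by `b` only changes the mean to `a - b`, and sublevel sets of a seminorm are
symmetric and convex, so Anderson's inequality removes any mismatch between `a` and `b`. -/
lemma multivariateGaussian_seminorm_sub_le (a b : Euc m) (S : Matrix (Fin m) (Fin m) ℝ)
    (G : Seminorm ℝ (Euc m)) (hGc : Continuous G) (c : ℝ) :
    (multivariateGaussian a S).real {x | G (x - b) ≤ c}
      ≤ (multivariateGaussian 0 S).real {x | G x ≤ c} := by
  have hm : MeasurableSet {x | G x ≤ c} := (isClosed_le hGc continuous_const).measurableSet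
  have hm' : MeasurableSet {x | G (x - b) ≤ c} :=
    (isClosed_le (hGc.comp (continuous_sub_right b)) continuous_const).measurableSet
  have h1 : multivariateGaussian a S {x | G (x - b) ≤ c}
      = multivariateGaussian (a - b) S {x | G x ≤ c} := by
    rw [multivariateGaussian_eq_map_add a, multivariateGaussian_eq_map_add (a - b),
      Measure.map_apply (by fun_prop) hm, Measure.map_apply (by fun_prop) hm']
    congr 1
    ext x
    simp [sub_eq_add_neg, add_right_comm]
  rw [measureReal_def, measureReal_def, h1]
  refine ENNReal.toReal_mono (measure_ne_top _ _) ?_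
  refine multivariateGaussian_apply_le_of_convex _ S hm ?_ fun x hx => ?_
  · simpa using G.convexOn.convex_le c
  · simpa using hx

lemma multivariateGaussian_norm_gt_le {a : Euc m} (S : Matrix (Fin m) (Fin m) ℝ) {r R : ℝ}
    (ha : ‖a‖ ≤ r) : (multivariateGaussian a S).real {x | R + r < ‖x‖}
      ≤ (multivariateGaussian 0 S).real {x | R < ‖x‖} := by
  rw [measureReal_def, measureReal_def, multivariateGaussian_eq_map_add a,
    Measure.map_apply (by fun_prop) (isOpen_lt continuous_const continuous_norm).measurableSet]
  refine ENNReal.toReal_mono (measure_ne_top _ _) (measure_mono fun x (hx : _ < ‖a + x‖) => ?_)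
  have := norm_add_le a x
  simp only [mem_ofPred_eq]
  linarith

lemma tendsto_measureReal_norm_gt {E : Type*} [NormedAddCommGroup E] [MeasurableSpace E]
    [BorelSpace E] (μ : Measure E) [IsFiniteMeasure μ] :
    Tendsto (fun R : ℝ => μ.real {x | R < ‖x‖}) atTop (𝓝 0) := by
  have h := tendsto_measure_iInter_atTop (μ := μ) (s := fun R : ℝ => {x : E | R < ‖x‖})
    (fun R => (isOpen_lt continuous_const continuous_norm).measurableSet.nullMeasurableSet)
    (fun R R' h x hx => lt_of_le_of_lt h hx) ⟨0, measure_ne_top _ _⟩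
  have he : ⋂ R : ℝ, {x : E | R < ‖x‖} = ∅ := by
    ext x
    simp only [mem_iInter, mem_ofPred_eq, mem_empty_iff_false, iff_false, not_forall, not_lt]
    exact ⟨‖x‖, le_rfl⟩
  rw [he, measure_empty] at h
  exact (ENNReal.tendsto_toReal ENNReal.zero_ne_top).comp h

end GaussianSeminorm

/-! ### Tightness of the normalised efficient score, and positivity of the information -/

section ScoreAverage

variable {𝒳 Λ Ω : Type*} [MeasurableSpace 𝒳] [MeasurableSpace Λ] [MeasurableSpace Ω]

/-- Scores are orthogonal to the constant 1, and this orthogonality passes to their closed linear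
span. -/
lemma IsEfficientScore.integral_eq_zero {p : ℕ} {P : Kernel Λ 𝒳} [IsMarkovKernel P]
    {φ : Λ → Euc p} {t₀ : Λ} {𝒞 : Set (ℝ → Λ)} {l : 𝒳 → Euc p} {I₀ : Matrix (Fin p) (Fin p) ℝ}
    (h : IsEfficientScore P φ t₀ 𝒞 l I₀) (j : Fin p) : ∫ x, l x j ∂(P t₀) = 0 := by
  set one : Lp ℝ 2 (P t₀) := (memLp_const (1 : ℝ)).toLp (fun _ : 𝒳 => (1 : ℝ))
  have hint : ∀ g : Lp ℝ 2 (P t₀), ⟪one, g⟫_ℝ = ∫ x, g x ∂(P t₀) := by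
    intro g
    rw [L2.inner_def]
    refine integral_congr_ae ?_
    filter_upwards [(memLp_const (μ := P t₀) (p := 2) (1 : ℝ)).coeFn_toLp] with x hx
    rw [hx]
    simp
  have hle : (Submodule.span ℝ (tangentSet P t₀ 𝒞)).topologicalClosure ≤ (ℝ ∙ one)ᗮ := by
    refine Submodule.topologicalClosure_minimal _ (Submodule.span_le.2 ?_)
      (Submodule.isClosed_orthogonal _)
    rintro g ⟨γ, -, hg⟩
    refine (Submodule.mem_orthogonal_singleton_iff_inner_right).2 ?_
    rw [hint, hg.2.1]
  have h1 := Submodule.mem_orthogonal_singleton_iff_inner_right.1 (hle (h.mem_closure_span j))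
  rw [hint] at h1
  rw [← h1]
  exact integral_congr_ae (h.memLp j).coeFn_toLp.symm

/-- Normalised sums of centred i.i.d. variables are bounded in probability. -/
lemma measure_abs_normalized_sum_ge_le {μ : Measure 𝒳} [IsProbabilityMeasure μ]
    {Pr : Measure Ω} [IsProbabilityMeasure Pr] {X : ℕ → Ω → 𝒳} (hX : ∀ i, Measurable (X i))
    (hX_indep : iIndepFun X Pr) (hX_law : ∀ i, Pr.map (X i) = μ) {y : 𝒳 → ℝ} (hy : MemLp y 2 μ)
    (hy0 : ∫ x, y x ∂μ = 0) (n : ℕ) {R : ℝ} (hR : 0 < R) :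
    Pr {ω | R ≤ |(√(n : ℝ))⁻¹ * ∑ i : Fin n, y (X i ω)|} ≤ ENNReal.ofReal (Var[y; μ] / R ^ 2) := by
  rcases Nat.eq_zero_or_pos n with rfl | hn
  · simp [hR.not_ge]
  have hmp : ∀ i, MeasurePreserving (X i) Pr μ := fun i => ⟨hX i, hX_law i⟩
  set Y : ℕ → Ω → ℝ := fun i ω => y (X i ω)
  have hY : ∀ i, MemLp (Y i) 2 Pr := fun i => hy.comp_measurePreserving (hmp i)
  have hYm : ∀ i, ∫ ω, Y i ω ∂Pr = 0 := fun i => by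
    rw [← hy0, ← (hmp i).map_eq, integral_map (hX i).aemeasurable]
    rw [(hmp i).map_eq]; exact hy.1
  have hvar : ∀ i, Var[Y i; Pr] = Var[y; μ] := fun i => by
    rw [← (hmp i).map_eq, variance_map]
    · rfl
    · rw [(hmp i).map_eq]; exact hy.1.aemeasurable
    · exact (hX i).aemeasurable
  have hind : iIndepFun Y Pr := hX_indep.comp₀ (fun _ => y) (fun i => (hX i).aemeasurable)
    (fun i => by rw [hX_law]; exact hy.1.aemeasurable)
  set Z : Ω → ℝ := fun ω => (√(n : ℝ))⁻¹ * ∑ i ∈ Finset.range n, Y i ω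
  have hsum : MemLp (fun ω => ∑ i ∈ Finset.range n, Y i ω) 2 Pr := memLp_finsetSum _ fun i _ => hY i
  have hZ : MemLp Z 2 Pr := hsum.const_mul _
  have hZm : ∫ ω, Z ω ∂Pr = 0 := by
    rw [integral_const_mul, integral_finsetSum _ fun i _ => (hY i).integrable one_le_two]
    simp [hYm]
  have hZv : Var[Z; Pr] = Var[y; μ] := by
    have h1 : Var[fun ω => ∑ i ∈ Finset.range n, Y i ω; Pr] = n * Var[y; μ] := by
      have := IndepFun.variance_sum (s := Finset.range n) (fun i _ => hY i)
        (fun i _ j _ hij => hind.indepFun hij)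
      simp only [hvar, Finset.sum_const, Finset.card_range, nsmul_eq_mul] at this
      rw [← this]
      congr 1
      ext ω
      simp
    rw [variance_const_mul, h1, inv_pow, Real.sq_sqrt (by positivity)]
    field_simp
  have := meas_ge_le_variance_div_sq hZ hR
  rw [hZm, hZv] at this
  simpa [Z, Y, Finset.sum_range] using this

/-- The normalised efficient score is bounded in probability. -/
lemma IsEfficientScore.exists_forall_measureReal_norm_scoreAverage_le {p : ℕ} {P : Kernel Λ 𝒳}
    [IsMarkovKernel P] {φ : Λ → Euc p} {t₀ : Λ} {𝒞 : Set (ℝ → Λ)} {l : 𝒳 → Euc p}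
    {I₀ : Matrix (Fin p) (Fin p) ℝ} (h : IsEfficientScore P φ t₀ 𝒞 l I₀)
    {Pr : Measure Ω} [IsProbabilityMeasure Pr] {X : ℕ → Ω → 𝒳} (hX : ∀ i, Measurable (X i))
    (hX_indep : iIndepFun X Pr) (hX_law : ∀ i, Pr.map (X i) = P t₀) {η : ℝ} (hη : 0 < η) :
    ∃ R, 0 < R ∧ ∀ n : ℕ, Pr.real {ω | R < ‖scoreAverage l I₀ n fun i => X i ω‖} ≤ η := by
  set y : Fin p → 𝒳 → ℝ := fun j x => ∑ k, I₀⁻¹ j k * l x k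
  have hy : ∀ j, MemLp (y j) 2 (P t₀) := fun j =>
    memLp_finsetSum _ fun k _ => (h.memLp k).const_mul _
  have hy0 : ∀ j, ∫ x, y j x ∂(P t₀) = 0 := fun j => by
    rw [integral_finsetSum _ fun k _ => ((h.memLp k).integrable one_le_two).const_mul _]
    simp [integral_const_mul, h.integral_eq_zero]
  set V := ∑ j, Var[y j; P t₀]
  have hV : 0 ≤ V := Finset.sum_nonneg fun j _ => variance_nonneg _ _
  obtain ⟨r, hr0, hr⟩ : ∃ r : ℝ, 0 < r ∧ V / r ^ 2 ≤ η := by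
    refine ⟨√(V / η) + 1, by positivity, ?_⟩
    rw [div_le_iff₀ (by positivity)]
    have h1 : V / η ≤ (√(V / η) + 1) ^ 2 := by
      have h2 := Real.sq_sqrt (div_nonneg hV hη.le)
      nlinarith [Real.sqrt_nonneg (V / η)]
    rw [div_le_iff₀ hη] at h1
    linarith
  -- If all `p` coordinates are below `r`, the norm is at most `p * r`; the factor `p + 1` keeps the
  -- radius positive when `p = 0`.
  refine ⟨(p + 1) * r, by positivity, fun n => ?_⟩
  have hcoord : ∀ (j : Fin p) ω, scoreAverage l I₀ n (fun i => X i ω) j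
      = (√(n : ℝ))⁻¹ * ∑ i : Fin n, y j (X i ω) := by
    intro j ω
    simp [scoreAverage, y, Matrix.mulVec, dotProduct]
  have hsub : {ω | (p + 1) * r < ‖scoreAverage l I₀ n fun i => X i ω‖}
      ⊆ ⋃ j, {ω | r ≤ |(√(n : ℝ))⁻¹ * ∑ i : Fin n, y j (X i ω)|} := by
    intro ω hω
    by_contra hcon
    simp only [mem_iUnion, mem_ofPred_eq, not_exists, not_le, ← hcoord] at hcon hω
    set v := scoreAverage l I₀ n fun i => X i ω
    have h1 : ‖v‖ ≤ ∑ j, |v j| := by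
      rw [EuclideanSpace.norm_eq]
      refine Real.sqrt_le_iff.2 ⟨by positivity, ?_⟩
      simpa using Finset.sum_sq_le_sq_sum_of_nonneg (s := Finset.univ) (f := fun j => |v j|)
        fun i _ => abs_nonneg _
    have h2 : ∑ j, |v j| ≤ ∑ _j : Fin p, r := Finset.sum_le_sum fun j _ => (hcon j).le
    simp at h2
    linarith
  have hle : Pr {ω | (p + 1) * r < ‖scoreAverage l I₀ n fun i => X i ω‖} ≤ ENNReal.ofReal η := by
    refine (measure_mono hsub).trans ((measure_iUnion_fintype_le _ _).trans ?_)
    refine (Finset.sum_le_sum fun j _ => measure_abs_normalized_sum_ge_le hX hX_indep hX_law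
      (hy j) (hy0 j) n hr0).trans ?_
    rw [← ENNReal.ofReal_sum_of_nonneg fun j _ => by
      have := variance_nonneg (y j) (P t₀); positivity, ← Finset.sum_div]
    exact ENNReal.ofReal_le_ofReal hr
  exact ENNReal.toReal_le_of_le_ofReal hη.le hle

/-- The quadratic form of `I₀` at `v` is E[(vᵀl)²] ≥ 0, and nonsingularity upgrades semidefinite to
definite. -/
lemma IsEfficientScore.posDef_inv_information {p : ℕ} {P : Kernel Λ 𝒳} [IsMarkovKernel P]
    {φ : Λ → Euc p} {t₀ : Λ} {𝒞 : Set (ℝ → Λ)} {l : 𝒳 → Euc p} {I₀ : Matrix (Fin p) (Fin p) ℝ}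
    (h : IsEfficientScore P φ t₀ 𝒞 l I₀) : I₀⁻¹.PosDef := by
  have hint : ∀ i j, Integrable (fun x => l x i * l x j) (P t₀) := fun i j =>
    (h.memLp i).integrable_mul (h.memLp j)
  have hpsd : I₀.PosSemidef := by
    refine Matrix.PosSemidef.of_dotProduct_mulVec_nonneg ?_ fun v => ?_
    · ext i j
      simp [h.information, mul_comm]
    · have h1 : star v ⬝ᵥ I₀ *ᵥ v = ∫ x, (∑ i, v i * l x i) ^ 2 ∂(P t₀) := by
        have h2 : ∀ x, (∑ i, v i * l x i) ^ 2 = ∑ i, ∑ j, v i * v j * (l x i * l x j) := by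
          intro x
          rw [sq, Finset.sum_mul_sum]
          refine Finset.sum_congr rfl fun i _ => Finset.sum_congr rfl fun j _ => by ring
        simp_rw [h2]
        rw [integral_finsetSum _ fun i _ => integrable_finsetSum _ fun j _ =>
          (hint i j).const_mul _]
        simp only [dotProduct, Matrix.mulVec, h.information, Finset.mul_sum, star_trivial]
        refine Finset.sum_congr rfl fun i _ => ?_
        rw [integral_finsetSum _ fun j _ => (hint i j).const_mul _]
        refine Finset.sum_congr rfl fun j _ => ?_
        rw [integral_const_mul]
        ring
      rw [h1]
      exact integral_nonneg fun x => sq_nonneg _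
  exact (hpsd.posDef_iff_isUnit.2 ((Matrix.isUnit_iff_isUnit_det _).2 h.nonsingular)).inv

end ScoreAverage

/-! ### Support functions: a priori bounds and one-sided expansion by Lagrangian duality -/

namespace MomentModel

variable {d p k : ℕ}

lemma frobNorm_nonneg {m n : ℕ} (A : Matrix (Fin m) (Fin n) ℝ) : 0 ≤ frobNorm A :=
  Real.sqrt_nonneg _

lemma norm_vecMul_le {m n : ℕ} (v : Euc m) (A : Matrix (Fin m) (Fin n) ℝ) :
    ‖(WithLp.toLp 2 (v.ofLp ᵥ* A) : Euc n)‖ ≤ ‖v‖ * frobNorm A := by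
  rw [EuclideanSpace.norm_eq, EuclideanSpace.norm_eq, frobNorm, ← Real.sqrt_mul (by positivity)]
  refine Real.sqrt_le_sqrt ?_
  rw [Finset.sum_comm (f := fun i j => A i j ^ 2), Finset.mul_sum]
  refine Finset.sum_le_sum fun j _ => ?_
  simpa [Matrix.vecMul, dotProduct] using
    Finset.sum_mul_sq_le_sq_mul_sq Finset.univ v.ofLp fun i => A i j

lemma inner_vecMul {m n : ℕ} (v : Fin m → ℝ) (A : Matrix (Fin m) (Fin n) ℝ) (h : Euc n) :
    ⟪(WithLp.toLp 2 (v ᵥ* A) : Euc n), h⟫_ℝ = ∑ i, v i * (A *ᵥ h.ofLp) i := by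
  have h1 : ⟪(WithLp.toLp 2 (v ᵥ* A) : Euc n), h⟫_ℝ = (v ᵥ* A) ⬝ᵥ h.ofLp := by
    simp [PiLp.inner_apply, dotProduct, mul_comm]
  rw [h1, ← Matrix.dotProduct_mulVec]
  rfl

lemma abs_row_le_frobNorm {m n : ℕ} (A : Matrix (Fin m) (Fin n) ℝ) (h : Euc n) (i : Fin m) :
    |(A *ᵥ h.ofLp) i| ≤ frobNorm A * ‖h‖ := by
  have h1 := inner_vecMul (Pi.single i 1) A h
  simp only [Pi.single_apply, ite_mul, one_mul, zero_mul, Finset.sum_ite_eq', Finset.mem_univ,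
    if_true] at h1
  rw [← h1]
  refine (abs_real_inner_le_norm _ _).trans ?_
  gcongr
  have := norm_vecMul_le (EuclideanSpace.single i (1 : ℝ)) A
  rwa [PiLp.norm_single, norm_one, one_mul] at this

variable (M : MomentModel d p k)

/-- The conditions on the moment function, on a fixed neighbourhood of the true value. -/
structure LocalConditions (φ₀ : Euc p) (lam : USphere d → Euc p → Euc k) (δ : ℝ) : Prop where
  pos : 0 < δ
  conv : M.ContinuousConvex
  param : M.ParameterSpaces φ₀
  reg : M.LocalRegularity φ₀ δ
  indep : M.IndependentGradients φ₀
  lin : M.SingletonOrLinear φ₀ δ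
  mult : ∀ ν, ∀ φ ∈ M.nbhd φ₀ δ, M.IsLagrangeMultiplier ν φ (lam ν φ)
  lip : M.LipschitzConditions φ₀ lam δ

/-- The derivative `λ(ν, φ₀)ᵀ ∇_φ Ψ(θ, φ₀)` of the Lagrangian. -/
noncomputable def lagrangeGrad (lam : USphere d → Euc p → Euc k) (φ₀ : Euc p) (ν : USphere d)
    (θ : Euc d) : Euc p :=
  WithLp.toLp 2 ((lam ν φ₀).ofLp ᵥ* M.jac θ φ₀)

variable {M} {φ₀ : Euc p} {lam : USphere d → Euc p → Euc k} {δ : ℝ}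

lemma supportFn_eq_of_mem {ν : USphere d} {φ : Euc p} {θ : Euc d} (h : θ ∈ M.supportSet ν φ) :
    M.supportFn φ ν = ⟪(ν : Euc d), θ⟫_ℝ := by
  refine IsLUB.csSup_eq (IsGreatest.isLUB ⟨⟨θ, h.1, real_inner_comm _ _⟩, ?_⟩) ⟨_, θ, h.1, rfl⟩
  rintro _ ⟨θ', hθ', rfl⟩
  simpa [real_inner_comm] using h.2 θ' hθ'

namespace LocalConditions

lemma exists_norm_le (hp : M.ParameterSpaces φ₀) : ∃ R, 0 < R ∧ ∀ θ ∈ M.Theta, ‖θ‖ ≤ R :=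
  hp.compact.isBounded.exists_pos_norm_le

lemma abs_supportFn_le {R : ℝ} (hR0 : 0 ≤ R) (hR : ∀ θ ∈ M.Theta, ‖θ‖ ≤ R) (φ : Euc p)
    (ν : USphere d) : |M.supportFn φ ν| ≤ R := by
  have hb : ∀ x ∈ (fun θ : Euc d => ⟪θ, (ν : Euc d)⟫_ℝ) '' M.identSet φ, |x| ≤ R := by
    rintro _ ⟨θ, hθ, rfl⟩
    have h1 := abs_real_inner_le_norm θ (ν : Euc d)
    rw [norm_eq_of_mem_sphere ν, mul_one] at h1
    exact h1.trans (hR θ hθ.1)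
  rcases (M.identSet φ).eq_empty_or_nonempty with he | ⟨θ, hθ⟩
  · simp [supportFn, he, hR0]
  · rw [abs_le]
    constructor
    · exact (neg_le_of_abs_le (hb _ ⟨θ, hθ, rfl⟩)).trans
        (le_csSup ⟨R, fun x hx => (abs_le.1 (hb x hx)).2⟩ ⟨θ, hθ, rfl⟩)
    · exact csSup_le ⟨_, θ, hθ, rfl⟩ fun x hx => (abs_le.1 (hb x hx)).2

lemma bddAbove_supportFn_sub (hp : M.ParameterSpaces φ₀) (φ₁ φ₂ : Euc p) :
    BddAbove (range fun ν : USphere d => |M.supportFn φ₁ ν - M.supportFn φ₂ ν|) := by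
  obtain ⟨R, hR0, hR⟩ := exists_norm_le hp
  refine ⟨2 * R, ?_⟩
  rintro _ ⟨ν, rfl⟩
  have h1 := abs_supportFn_le hR0.le hR φ₁ ν
  have h2 := abs_supportFn_le hR0.le hR φ₂ ν
  have := abs_sub (M.supportFn φ₁ ν) (M.supportFn φ₂ ν)
  simp only
  linarith

lemma mem_nbhd_self (H : M.LocalConditions φ₀ lam δ) : φ₀ ∈ M.nbhd φ₀ δ :=
  ⟨interior_subset H.param.mem_interior, by simpa using H.pos.le⟩

lemma exists_closedBall_subset (H : M.LocalConditions φ₀ lam δ) :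
    ∃ r, 0 < r ∧ closedBall φ₀ r ⊆ M.nbhd φ₀ δ := by
  obtain ⟨r, hr, hsub⟩ := nhds_basis_closedBall.mem_iff.1
    (mem_interior_iff_mem_nhds.1 H.param.mem_interior)
  refine ⟨min r δ, lt_min hr H.pos, fun φ hφ => ⟨hsub ?_, ?_⟩⟩
  · exact closedBall_subset_closedBall (min_le_left _ _) hφ
  · rw [← dist_eq_norm]
    exact (mem_closedBall.1 hφ).trans (min_le_right _ _)

lemma continuousOn_Psi (hc : M.ContinuousConvex) {φ : Euc p} (hφ : φ ∈ M.Phi) (i : Fin k) :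
    ContinuousOn (fun θ => M.Psi θ φ i) M.Theta := by
  have h1 : ContinuousOn (fun θ => M.Psi θ φ) M.Theta :=
    hc.continuousOn.comp (f := fun θ => (θ, φ)) (by fun_prop) fun θ hθ => ⟨hθ, hφ⟩
  exact (EuclideanSpace.proj (𝕜 := ℝ) i).continuous.comp_continuousOn h1

lemma isClosed_identSet (hc : M.ContinuousConvex) (hp : M.ParameterSpaces φ₀) {φ : Euc p}
    (hφ : φ ∈ M.Phi) : IsClosed (M.identSet φ) := by
  have h1 : M.identSet φ = M.Theta ∩ ⋂ i, M.Theta ∩ (fun θ => M.Psi θ φ i) ⁻¹' Iic 0 := by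
    ext θ
    simp only [identSet, mem_ofPred_eq, mem_inter_iff, mem_iInter, mem_preimage, mem_Iic]
    exact ⟨fun h => ⟨h.1, fun i => ⟨h.1, h.2 i⟩⟩, fun h => ⟨h.1, fun i => (h.2 i).2⟩⟩
  rw [h1]
  exact hp.compact.isClosed.inter (isClosed_iInter fun i =>
    (continuousOn_Psi hc hφ i).preimage_isClosed_of_isClosed hp.compact.isClosed isClosed_Iic)

lemma convex_identSet (hc : M.ContinuousConvex) (hp : M.ParameterSpaces φ₀) {φ : Euc p}
    (hφ : φ ∈ M.Phi) : Convex ℝ (M.identSet φ) := by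
  intro x hx y hy a b ha hb hab
  refine ⟨hp.convex hx.1 hy.1 ha hb hab, fun i => ?_⟩
  refine ((hc.convexOn φ hφ i).2 hx.1 hy.1 ha hb hab).trans ?_
  simp only [smul_eq_mul]
  nlinarith [hx.2 i, hy.2 i]

lemma exists_mem_supportSet (H : M.LocalConditions φ₀ lam δ) {φ : Euc p}
    (hφ : φ ∈ M.nbhd φ₀ δ) (ν : USphere d) : ∃ θ, θ ∈ M.supportSet ν φ := by
  have hcomp : IsCompact (M.identSet φ) :=
    H.param.compact.of_isClosed_subset (isClosed_identSet H.conv H.param hφ.1) fun θ h => h.1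
  obtain ⟨θ, hθ, hmax⟩ := hcomp.exists_isMaxOn (H.reg.nonempty φ hφ)
    (f := fun θ => ⟪(ν : Euc d), θ⟫_ℝ) (by fun_prop)
  exact ⟨θ, hθ, fun θ' hθ' => hmax hθ'⟩

lemma inner_sub_le_supportFn (H : M.LocalConditions φ₀ lam δ) {φ : Euc p}
    (hφ : φ ∈ M.nbhd φ₀ δ) (ν : USphere d) {θ : Euc d} (hθ : θ ∈ M.Theta) :
    ⟪(ν : Euc d), θ⟫_ℝ - ∑ i, lam ν φ i * M.Psi θ φ i ≤ M.supportFn φ ν :=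
  (H.mult ν φ hφ).2.1 ⟨θ, hθ, rfl⟩

/-- Slater's condition bounds the multipliers at the true value. -/
lemma exists_norm_lam_le (H : M.LocalConditions φ₀ lam δ) : ∃ B, 0 ≤ B ∧ ∀ ν, ‖lam ν φ₀‖ ≤ B := by
  obtain ⟨θ, hθ, hθn⟩ := H.reg.slater φ₀ H.mem_nbhd_self
  obtain ⟨R, hR0, hR⟩ := exists_norm_le H.param
  set B := ∑ i, 2 * R / (-M.Psi θ φ₀ i)
  have hpos : ∀ i, 0 < -M.Psi θ φ₀ i := fun i => by linarith [hθn i]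
  have hB0 : ∀ i, 0 ≤ 2 * R / (-M.Psi θ φ₀ i) := fun i => by have := hpos i; positivity
  refine ⟨B, Finset.sum_nonneg fun i _ => hB0 i, fun ν => ?_⟩
  have hlam0 := (H.mult ν φ₀ H.mem_nbhd_self).1
  have h1 := H.inner_sub_le_supportFn H.mem_nbhd_self ν hθ
  have h2 := (abs_le.1 (abs_supportFn_le hR0.le hR φ₀ ν)).2
  have h3 : -R ≤ ⟪(ν : Euc d), θ⟫_ℝ := by
    have h4 := abs_real_inner_le_norm (ν : Euc d) θ
    rw [norm_eq_of_mem_sphere ν, one_mul] at h4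
    exact neg_le_of_abs_le (h4.trans (hR θ hθ))
  -- At the Slater point all terms `-λ_i Ψ_i` are nonnegative, and their sum is at most S_φ₀(ν) -
  -- νᵀθ ≤ 2R.
  have hi : ∀ i, lam ν φ₀ i ≤ 2 * R / (-M.Psi θ φ₀ i) := by
    intro i
    rw [le_div_iff₀ (hpos i)]
    have h5 : lam ν φ₀ i * (-M.Psi θ φ₀ i) ≤ ∑ i, lam ν φ₀ i * (-M.Psi θ φ₀ i) :=
      Finset.single_le_sum (f := fun i => lam ν φ₀ i * (-M.Psi θ φ₀ i))
        (fun j _ => mul_nonneg (hlam0 j) (hpos j).le) (Finset.mem_univ i)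
    have h6 : ∑ i, lam ν φ₀ i * (-M.Psi θ φ₀ i) = -∑ i, lam ν φ₀ i * M.Psi θ φ₀ i := by
      simp
    linarith
  have hnorm : ‖lam ν φ₀‖ ≤ ∑ i, lam ν φ₀ i := by
    rw [EuclideanSpace.norm_eq]
    refine Real.sqrt_le_iff.2 ⟨Finset.sum_nonneg fun i _ => hlam0 i, ?_⟩
    simpa using Finset.sum_sq_le_sq_sum_of_nonneg (s := Finset.univ) (f := fun j => lam ν φ₀ j)
      fun i _ => hlam0 i
  exact hnorm.trans (Finset.sum_le_sum fun i _ => hi i)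

lemma fderiv_eq_jac (θ : Euc d) (φ : Euc p) (i : Fin k) (h : Euc p) :
    fderiv ℝ (fun φ' => M.Psi θ φ' i) φ h = (M.jac θ φ *ᵥ h.ofLp) i := by
  have h1 : h = ∑ j, h j • EuclideanSpace.single j (1 : ℝ) := by
    ext j
    simp [Pi.single_apply]
  conv_lhs => rw [h1]
  rw [map_sum]
  simp [jac, Matrix.mulVec, dotProduct, mul_comm]

/-- First-order expansion of the moment function in the point identified parameter. -/
lemma abs_Psi_sub_le (H : M.LocalConditions φ₀ lam δ) {K r : ℝ} (hK : 0 ≤ K)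
    (hjac : ∀ φ₁ ∈ M.nbhd φ₀ δ, ∀ φ₂ ∈ M.nbhd φ₀ δ, ∀ θ ∈ M.Theta,
      frobNorm (M.jac θ φ₁ - M.jac θ φ₂) ≤ K * ‖φ₁ - φ₂‖)
    (hr : closedBall φ₀ r ⊆ M.nbhd φ₀ δ) {φ₁ φ₂ : Euc p} (h₁ : φ₁ ∈ closedBall φ₀ r)
    (h₂ : φ₂ ∈ closedBall φ₀ r) {θ : Euc d} (hθ : θ ∈ M.Theta) (i : Fin k) :
    |M.Psi θ φ₁ i - M.Psi θ φ₂ i - (M.jac θ φ₀ *ᵥ (φ₁ - φ₂).ofLp) i|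
      ≤ K * r * ‖φ₁ - φ₂‖ := by
  have key := (convex_closedBall φ₀ r).norm_image_sub_le_of_norm_fderiv_le'
    (f := fun φ' => M.Psi θ φ' i) (φ := fderiv ℝ (fun φ' => M.Psi θ φ' i) φ₀) (C := K * r)
    (𝕜 := ℝ) (fun φ hφ => H.reg.differentiable_phi θ hθ φ (hr hφ) i) (fun φ hφ => ?_) h₂ h₁
  · rw [fderiv_eq_jac] at key
    simpa using key
  · have hr0 : 0 ≤ r := dist_nonneg.trans (mem_closedBall.1 h₁)
    refine ContinuousLinearMap.opNorm_le_bound _ (by positivity) fun h => ?_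
    rw [sub_apply, fderiv_eq_jac, fderiv_eq_jac, ← Pi.sub_apply,
      ← Matrix.sub_mulVec, Real.norm_eq_abs]
    refine (abs_row_le_frobNorm _ h i).trans ?_
    gcongr
    refine (hjac φ (hr hφ) φ₀ H.mem_nbhd_self θ hθ).trans ?_
    rw [← dist_eq_norm]
    gcongr
    exact hφ

lemma exists_frobNorm_jac_le (H : M.LocalConditions φ₀ lam δ) :
    ∃ B, 0 ≤ B ∧ ∀ θ ∈ M.Theta, frobNorm (M.jac θ φ₀) ≤ B := by
  have hcont : ContinuousOn (fun θ => frobNorm (M.jac θ φ₀)) M.Theta := by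
    have h1 : ContinuousOn (fun θ => M.jac θ φ₀) M.Theta :=
      H.reg.continuous_jac.comp (f := fun θ => (θ, φ₀)) (by fun_prop)
        fun θ hθ => ⟨hθ, H.mem_nbhd_self⟩
    have h2 : Continuous fun A : Matrix (Fin k) (Fin p) ℝ => frobNorm A := by
      unfold frobNorm
      refine Real.continuous_sqrt.comp (continuous_finsetSum _ fun i _ =>
        continuous_finsetSum _ fun j _ => ?_)
      exact (continuous_id.matrix_elem i j).pow 2
    exact h2.comp_continuousOn h1
  obtain ⟨B, hB⟩ := (H.param.compact.image_of_continuousOn hcont).bddAbove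
  exact ⟨max B 0, le_max_right _ _, fun θ hθ => (hB ⟨θ, hθ, rfl⟩).trans (le_max_left _ _)⟩

/-- One-sided expansion of the support function at an arbitrary maximiser. -/
lemma exists_supportFn_sub_le (H : M.LocalConditions φ₀ lam δ) {ε : ℝ} (hε : 0 < ε) :
    ∃ r, 0 < r ∧ closedBall φ₀ r ⊆ M.nbhd φ₀ δ ∧
      ∀ φ₁ ∈ closedBall φ₀ r, ∀ φ₂ ∈ closedBall φ₀ r, ∀ ν, ∀ θ ∈ M.supportSet ν φ₁,
        M.supportFn φ₁ ν - M.supportFn φ₂ ν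
          ≤ -⟪M.lagrangeGrad lam φ₀ ν θ, φ₁ - φ₂⟫_ℝ + ε * ‖φ₁ - φ₂‖ := by
  obtain ⟨K, hK, hlam, hjac, -⟩ := H.lip
  obtain ⟨B, hB0, hB⟩ := H.exists_norm_lam_le
  obtain ⟨J, hJ0, hJ⟩ := H.exists_frobNorm_jac_le
  obtain ⟨r₀, hr₀, hr₀s⟩ := H.exists_closedBall_subset
  -- The first term is the Taylor remainder of `k` constraints, weighted by multipliers at most `B +
  -- K * r`; the second is the cost of replacing λ(ν, φ₂) by λ(ν, φ₀).
  obtain ⟨r, ⟨hrε, hrr⟩, hr⟩ : ∃ r, (k * ((B + K * r) * (K * r)) + K * r * J < ε ∧ r < r₀) ∧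
      0 < r := by
    have h1 : Tendsto (fun r : ℝ => k * ((B + K * r) * (K * r)) + K * r * J) (𝓝 0)
        (𝓝 (k * ((B + K * 0) * (K * 0)) + K * 0 * J)) := by
      refine Continuous.tendsto ?_ 0
      fun_prop
    have h2 := (h1.eventually_lt_const (u := ε) (by simpa using hε)).and
      (eventually_lt_nhds hr₀)
    exact ((h2.filter_mono nhdsWithin_le_nhds).and (self_mem_nhdsWithin (s := Ioi 0))).exists
  have hrs : closedBall φ₀ r ⊆ M.nbhd φ₀ δ :=
    (closedBall_subset_closedBall hrr.le).trans hr₀s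
  refine ⟨r, hr, hrs, fun φ₁ h₁ φ₂ h₂ ν θ hθ => ?_⟩
  have hθT : θ ∈ M.Theta := hθ.1.1
  set D := φ₁ - φ₂
  have hlam2 := (H.mult ν φ₂ (hrs h₂)).1
  have hdiff : ‖lam ν φ₂ - lam ν φ₀‖ ≤ K * r := by
    refine (hlam φ₂ (hrs h₂) φ₀ H.mem_nbhd_self ν).trans ?_
    rw [← dist_eq_norm]
    gcongr
    exact h₂
  have hlam2B : ∀ i, lam ν φ₂ i ≤ B + K * r := by
    intro i
    have h1 : |lam ν φ₂ i| ≤ ‖lam ν φ₂‖ := by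
      simpa using PiLp.norm_apply_le (lam ν φ₂) i
    have h2 : ‖lam ν φ₂‖ ≤ ‖lam ν φ₀‖ + ‖lam ν φ₂ - lam ν φ₀‖ := norm_le_insert' _ _
    linarith [le_abs_self (lam ν φ₂ i), hB ν]
  -- Weak duality: the maximiser `θ` for φ₁ is tested in the Lagrangian at φ₂. As Ψ(θ, φ₁) ≤ 0, the
  -- value Ψ(θ, φ₂) is bounded by the increment alone.
  have h1 := H.inner_sub_le_supportFn (hrs h₂) ν hθT
  rw [supportFn_eq_of_mem hθ]
  have h2 : ∑ i, lam ν φ₂ i * M.Psi θ φ₂ i ≤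
      ∑ i, (lam ν φ₂ i * -(M.jac θ φ₀ *ᵥ D.ofLp) i + (B + K * r) * (K * r * ‖D‖)) := by
    refine Finset.sum_le_sum fun i _ => ?_
    have h3 := (abs_le.1 (H.abs_Psi_sub_le hK.le hjac hrs h₁ h₂ hθT i)).1
    have h4 := hθ.1.2 i
    have h5 : M.Psi θ φ₂ i ≤ -(M.jac θ φ₀ *ᵥ D.ofLp) i + K * r * ‖D‖ := by linarith
    have h6 : 0 ≤ K * r * ‖D‖ := by positivity
    calc lam ν φ₂ i * M.Psi θ φ₂ i
        ≤ lam ν φ₂ i * (-(M.jac θ φ₀ *ᵥ D.ofLp) i + K * r * ‖D‖) :=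
          mul_le_mul_of_nonneg_left h5 (hlam2 i)
      _ = lam ν φ₂ i * -(M.jac θ φ₀ *ᵥ D.ofLp) i + lam ν φ₂ i * (K * r * ‖D‖) := by ring
      _ ≤ _ := by
          gcongr
          exact hlam2B i
  have h3 : ∑ i, lam ν φ₂ i * -(M.jac θ φ₀ *ᵥ D.ofLp) i
      = -⟪M.lagrangeGrad lam φ₀ ν θ, D⟫_ℝ
        - ⟪(WithLp.toLp 2 ((lam ν φ₂ - lam ν φ₀).ofLp ᵥ* M.jac θ φ₀) : Euc p), D⟫_ℝ := by
    rw [lagrangeGrad, inner_vecMul, inner_vecMul, ← Finset.sum_neg_distrib,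
      ← Finset.sum_sub_distrib]
    refine Finset.sum_congr rfl fun i _ => ?_
    simp
    ring
  have h4 : |⟪(WithLp.toLp 2 ((lam ν φ₂ - lam ν φ₀).ofLp ᵥ* M.jac θ φ₀) : Euc p), D⟫_ℝ|
      ≤ K * r * J * ‖D‖ := by
    refine (abs_real_inner_le_norm _ _).trans ?_
    gcongr
    refine (norm_vecMul_le _ _).trans ?_
    gcongr
    · exact frobNorm_nonneg _
    · exact hJ θ hθT
  rw [Finset.sum_add_distrib, h3, Finset.sum_const, Finset.card_univ, Fintype.card_fin,
    nsmul_eq_mul] at h2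
  have h5 := (abs_le.1 h4).1
  have h6 : (k * ((B + K * r) * (K * r)) + K * r * J) * ‖D‖ ≤ ε * ‖D‖ := by gcongr
  linarith

end LocalConditions
end MomentModel

/-- Perturbing a direction `ν` towards `m`, one reaches, through directions with a unique maximiser
over `C`, a maximiser in the direction `ν` at which `m` is at least as large as at a given one. -/
lemma exists_seq_unique_maximiser {d : ℕ} {C : Set (Euc d)} (hC : IsCompact C) (ν : USphere d)
    (m : Euc d) {θ : Euc d} (hθ : θ ∈ C) (hmax : ∀ x ∈ C, ⟪(ν : Euc d), x⟫_ℝ ≤ ⟪(ν : Euc d), θ⟫_ℝ) :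
    ∃ (u : ℕ → USphere d) (x : ℕ → Euc d) (y : Euc d), Tendsto u atTop (𝓝 ν) ∧
      Tendsto x atTop (𝓝 y) ∧ (∀ j, x j ∈ C) ∧
      (∀ j, ∀ z ∈ C, z ≠ x j → ⟪(u j : Euc d), z⟫_ℝ < ⟪(u j : Euc d), x j⟫_ℝ) ∧
      ⟪m, θ⟫_ℝ ≤ ⟪m, y⟫_ℝ := by
  obtain ⟨R, hR0, hR⟩ := hC.isBounded.exists_pos_norm_le
  have hνn : ‖(ν : Euc d)‖ = 1 := norm_eq_of_mem_sphere ν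
  -- The offset guarantees `s j ^ 2 > R + s j * ‖m‖`, so that the vectors `x j + q j` below do not
  -- vanish.
  set s : ℕ → ℝ := fun j => j + (‖m‖ + R + 1) with hs
  have hs1 : ∀ j, ‖m‖ + R + 1 ≤ s j := fun j => by simp [hs]
  have hspos : ∀ j, 0 < s j := fun j => by linarith [hs1 j, norm_nonneg m]
  have hsTop : Tendsto s atTop atTop :=
    tendsto_atTop_add_const_right _ _ tendsto_natCast_atTop_atTop
  -- The point of `C` farthest from `-q j` is the unique maximiser in its own direction `x j + q j`.
  -- The three scales make ν dominate, `m` break ties, and the bounded `x j` negligible.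
  set q : ℕ → Euc d := fun j => s j ^ 2 • (ν : Euc d) + s j • m with hq
  have hex : ∀ j, ∃ x ∈ C, ∀ z ∈ C, ‖z + q j‖ ≤ ‖x + q j‖ := fun j => by
    obtain ⟨x, hx, hxm⟩ := hC.exists_isMaxOn ⟨θ, hθ⟩ (f := fun z => ‖z + q j‖) (by fun_prop)
    exact ⟨x, hx, fun z hz => hxm hz⟩
  choose x hxC hxmax using hex
  have hw : ∀ j, x j + q j ≠ 0 := by
    intro j h0
    have h1 : s j ^ 2 • (ν : Euc d) = -(x j + s j • m) := by
      have h2 : s j ^ 2 • (ν : Euc d) + (x j + s j • m) = x j + q j := by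
        simp only [hq]
        abel
      rw [eq_neg_iff_add_eq_zero, h2, h0]
    have h2 : s j ^ 2 ≤ R + s j * ‖m‖ := by
      calc s j ^ 2 = ‖s j ^ 2 • (ν : Euc d)‖ := by
            rw [norm_smul, hνn, mul_one, Real.norm_of_nonneg (sq_nonneg _)]
        _ = ‖x j + s j • m‖ := by rw [h1, norm_neg]
        _ ≤ ‖x j‖ + ‖s j • m‖ := norm_add_le _ _
        _ ≤ R + s j * ‖m‖ := by
            rw [norm_smul, Real.norm_of_nonneg (hspos j).le]
            gcongr
            exact hR _ (hxC j)
    nlinarith [hs1 j, hspos j, norm_nonneg m]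
  set w : ℕ → Euc d := fun j => x j + q j with hwdef
  set u : ℕ → USphere d := fun j => ⟨‖w j‖⁻¹ • w j, by
    rw [mem_sphere_zero_iff_norm]
    exact norm_smul_inv_norm (𝕜 := ℝ) (hw j)⟩ with hu
  have huniq : ∀ j, ∀ z ∈ C, z ≠ x j → ⟪(u j : Euc d), z⟫_ℝ < ⟪(u j : Euc d), x j⟫_ℝ := by
    intro j z hz hne
    simp only [hu, inner_smul_left]
    refine mul_lt_mul_of_pos_left ?_ (by simpa using hw j)
    by_contra hcon
    push Not at hcon
    have h1 : ‖z - x j‖ ^ 2 = ‖z + q j‖ ^ 2 - 2 * ⟪w j, z + q j⟫_ℝ + ‖w j‖ ^ 2 := by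
      have h2 : z - x j = (z + q j) - w j := by simp [hwdef]
      rw [h2, norm_sub_sq_real, real_inner_comm]
    have h3 : ⟪w j, w j⟫_ℝ ≤ ⟪w j, z + q j⟫_ℝ := by
      have h4 : ⟪w j, w j⟫_ℝ = ⟪w j, x j⟫_ℝ + ⟪w j, q j⟫_ℝ := by
        rw [← inner_add_right]
      have h5 : ⟪w j, z + q j⟫_ℝ = ⟪w j, z⟫_ℝ + ⟪w j, q j⟫_ℝ := inner_add_right _ _ _
      linarith
    rw [real_inner_self_eq_norm_sq] at h3
    have h5 : ‖z + q j‖ ^ 2 ≤ ‖w j‖ ^ 2 := by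
      have := hxmax j z hz
      gcongr
    have h6 : ‖z - x j‖ ^ 2 ≤ 0 := by linarith
    have h7 : ‖z - x j‖ = 0 := by nlinarith [norm_nonneg (z - x j)]
    exact hne (sub_eq_zero.1 (norm_eq_zero.1 h7))
  have hlim : Tendsto u atTop (𝓝 ν) := by
    rw [tendsto_subtype_rng]
    have hinv : Tendsto (fun j => (s j)⁻¹) atTop (𝓝 0) := tendsto_inv_atTop_zero.comp hsTop
    have h1 : Tendsto (fun j => (s j ^ 2)⁻¹ • w j) atTop (𝓝 (ν : Euc d)) := by
      have h2 : ∀ j, (s j ^ 2)⁻¹ • w j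
          = (ν : Euc d) + (s j)⁻¹ • m + ((s j)⁻¹ * (s j)⁻¹) • x j := by
        intro j
        have := (hspos j).ne'
        simp only [hwdef, hq, smul_add, smul_smul]
        rw [inv_mul_cancel₀ (by positivity), one_smul]
        have h3 : (s j ^ 2)⁻¹ * s j = (s j)⁻¹ := by field_simp
        rw [h3, sq, mul_inv]
        abel
      simp_rw [h2]
      have h4 : Tendsto (fun j => ((s j)⁻¹ * (s j)⁻¹) • x j) atTop (𝓝 0) := by
        refine squeeze_zero_norm (a := fun j => (s j)⁻¹ * (s j)⁻¹ * R) (fun j => ?_) ?_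
        · have := hspos j
          rw [norm_smul, Real.norm_of_nonneg (by positivity)]
          gcongr
          exact hR _ (hxC j)
        · simpa using (hinv.mul hinv).mul_const R
      simpa using (tendsto_const_nhds.add (hinv.smul_const m)).add h4
    have h3 : Tendsto (fun j => ‖(s j ^ 2)⁻¹ • w j‖⁻¹ • ((s j ^ 2)⁻¹ • w j)) atTop
        (𝓝 (‖(ν : Euc d)‖⁻¹ • (ν : Euc d))) :=
      (h1.norm.inv₀ (by rw [hνn]; exact one_ne_zero)).smul h1
    rw [hνn, inv_one, one_smul] at h3
    refine h3.congr fun j => ?_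
    have hs2 : 0 < s j ^ 2 := by have := hspos j; positivity
    rw [norm_smul, norm_inv, Real.norm_of_nonneg hs2.le, smul_smul, mul_inv, inv_inv]
    congr 1
    rw [mul_right_comm, mul_inv_cancel₀ hs2.ne', one_mul]
  -- Compare the distances of `θ` and `x j` from `-q j`: the terms of order `s j ^ 2` have a
  -- favourable sign because `θ` maximises ν.
  have hm : ∀ j, ⟪m, θ⟫_ℝ - ⟪m, x j⟫_ℝ ≤ R ^ 2 * (s j)⁻¹ := by
    intro j
    have h1 : ‖θ + q j‖ ^ 2 ≤ ‖x j + q j‖ ^ 2 := by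
      have := hxmax j θ hθ
      gcongr
    rw [norm_add_sq_real θ, norm_add_sq_real (x j)] at h1
    simp only [hq, inner_add_right, inner_smul_right] at h1
    have h2 := hmax _ (hxC j)
    rw [real_inner_comm θ, real_inner_comm (x j)] at h2
    have h3 : ‖x j‖ ^ 2 ≤ R ^ 2 := by
      have := hR _ (hxC j)
      gcongr
    rw [← div_eq_mul_inv, le_div_iff₀ (hspos j), real_inner_comm θ, real_inner_comm (x j)]
    have h4 := mul_le_mul_of_nonneg_left h2 (sq_nonneg (s j))
    nlinarith [sq_nonneg ‖θ‖, sq_nonneg R]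
  obtain ⟨y, -, ψ, hψ, hy⟩ := hC.tendsto_subseq hxC
  refine ⟨u ∘ ψ, x ∘ ψ, y, hlim.comp hψ.tendsto_atTop, hy, fun j => hxC _, fun j => huniq _, ?_⟩
  have h1 : Tendsto (fun j => ⟪m, θ⟫_ℝ - ⟪m, x (ψ j)⟫_ℝ) atTop (𝓝 (⟪m, θ⟫_ℝ - ⟪m, y⟫_ℝ)) :=
    tendsto_const_nhds.sub (tendsto_const_nhds.inner hy)
  have h2 : Tendsto (fun j => R ^ 2 * (s (ψ j))⁻¹) atTop (𝓝 (R ^ 2 * 0)) :=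
    ((tendsto_inv_atTop_zero.comp (hsTop.comp hψ.tendsto_atTop))).const_mul _
  have := le_of_tendsto_of_tendsto' h1 h2 fun j => hm _
  linarith

/-! ### Closed graph of the support correspondence; uniqueness and continuity of the multipliers -/

namespace MomentModel

variable {d p k : ℕ} {M : MomentModel d p k} {φ₀ : Euc p} {lam : USphere d → Euc p → Euc k} {δ : ℝ}

namespace LocalConditions

lemma tendsto_Psi (H : M.LocalConditions φ₀ lam δ) {φ : ℕ → Euc p} {θ : ℕ → Euc d} {θ₀ : Euc d}
    (hφ : Tendsto φ atTop (𝓝 φ₀)) (hθ : Tendsto θ atTop (𝓝 θ₀)) (hmem : ∀ j, θ j ∈ M.Theta)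
    (i : Fin k) : Tendsto (fun j => M.Psi (θ j) (φ j) i) atTop (𝓝 (M.Psi θ₀ φ₀ i)) := by
  have hθ₀ : θ₀ ∈ M.Theta :=
    H.param.compact.isClosed.mem_of_tendsto hθ (Eventually.of_forall hmem)
  have hΦ : ∀ᶠ j in atTop, φ j ∈ M.Phi :=
    hφ.eventually (mem_interior_iff_mem_nhds.1 H.param.mem_interior)
  have h1 := H.conv.continuousOn (θ₀, φ₀) ⟨hθ₀, interior_subset H.param.mem_interior⟩
  have h2 : Tendsto (fun j => (θ j, φ j)) atTop (𝓝[M.Theta ×ˢ M.Phi] (θ₀, φ₀)) :=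
    tendsto_nhdsWithin_iff.2 ⟨hθ.prodMk_nhds hφ, hΦ.mono fun j hj => ⟨hmem j, hj⟩⟩
  exact ((EuclideanSpace.proj (𝕜 := ℝ) i).continuous.tendsto _).comp (h1.tendsto.comp h2)

/-- The support correspondence has a closed graph at the true value. -/
lemma mem_supportSet_of_tendsto (H : M.LocalConditions φ₀ lam δ) {ν : ℕ → USphere d}
    {φ : ℕ → Euc p} {θ : ℕ → Euc d} {ν₀ : USphere d} {θ₀ : Euc d} (hν : Tendsto ν atTop (𝓝 ν₀))
    (hφ : Tendsto φ atTop (𝓝 φ₀)) (hθ : Tendsto θ atTop (𝓝 θ₀))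
    (hmem : ∀ j, θ j ∈ M.supportSet (ν j) (φ j)) : θ₀ ∈ M.supportSet ν₀ φ₀ := by
  have hν' : Tendsto (fun j => (ν j : Euc d)) atTop (𝓝 (ν₀ : Euc d)) :=
    (continuous_subtype_val.tendsto _).comp hν
  refine ⟨⟨H.param.compact.isClosed.mem_of_tendsto hθ (Eventually.of_forall fun j => (hmem j).1.1),
    fun i => le_of_tendsto' (H.tendsto_Psi hφ hθ (fun j => (hmem j).1.1) i)
      fun j => (hmem j).1.2 i⟩, fun θ' hθ' => ?_⟩
  -- A competitor `θ'` feasible at φ₀ may be infeasible at `φ j`. Moved slightly towards a Slater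
  -- point it becomes strictly feasible, hence feasible for large `j`; then `t` tends to 0.
  obtain ⟨θs, hθs, hslater⟩ := H.reg.slater φ₀ H.mem_nbhd_self
  have hconv := H.conv.convexOn φ₀ H.mem_nbhd_self.1
  have key : ∀ t ∈ Ioo (0 : ℝ) 1,
      ⟪(ν₀ : Euc d), (1 - t) • θ' + t • θs⟫_ℝ ≤ ⟪(ν₀ : Euc d), θ₀⟫_ℝ := by
    intro t ht
    set z := (1 - t) • θ' + t • θs
    have hz : z ∈ M.Theta := H.param.convex hθ'.1 hθs (by linarith [ht.2]) ht.1.le (by ring)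
    have hneg : ∀ i, M.Psi z φ₀ i < 0 := fun i => by
      refine ((hconv i).2 hθ'.1 hθs (by linarith [ht.2]) ht.1.le (by ring)).trans_lt ?_
      simp only [smul_eq_mul]
      have h1 := mul_nonneg (by linarith [ht.2] : (0 : ℝ) ≤ 1 - t) (neg_nonneg.2 (hθ'.2 i))
      have h2 := mul_pos ht.1 (neg_pos.2 (hslater i))
      linarith
    have hev : ∀ᶠ j in atTop, z ∈ M.identSet (φ j) := by
      have h1 : ∀ᶠ j in atTop, ∀ i, M.Psi z (φ j) i < 0 := eventually_all.2 fun i =>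
        (H.tendsto_Psi hφ (tendsto_const_nhds (x := z)) (fun _ => hz) i).eventually_lt_const
          (hneg i)
      exact h1.mono fun j hj => ⟨hz, fun i => (hj i).le⟩
    exact le_of_tendsto_of_tendsto (hν'.inner tendsto_const_nhds) (hν'.inner hθ)
      (hev.mono fun j hj => (hmem j).2 z hj)
  have hlim : Tendsto (fun t : ℝ => ⟪(ν₀ : Euc d), (1 - t) • θ' + t • θs⟫_ℝ) (𝓝[>] 0)
      (𝓝 ⟪(ν₀ : Euc d), (1 - (0 : ℝ)) • θ' + (0 : ℝ) • θs⟫_ℝ) :=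
    (Continuous.tendsto (by fun_prop) 0).mono_left nhdsWithin_le_nhds
  rw [sub_zero, one_smul, zero_smul, add_zero] at hlim
  exact le_of_tendsto hlim (mem_of_superset (Ioo_mem_nhdsGT one_pos) key)

/-- Complementary slackness: the Lagrangian bound at the maximiser makes a sum of nonpositive terms
nonnegative. -/
lemma mul_Psi_eq_zero {ν : USphere d} {θ : Euc d} (hθ : θ ∈ M.supportSet ν φ₀) {v : Euc k}
    (hv : ∀ i, 0 ≤ v i) (hle : ∀ θ' ∈ M.Theta,
      ⟪(ν : Euc d), θ'⟫_ℝ - ∑ i, v i * M.Psi θ' φ₀ i ≤ M.supportFn φ₀ ν) (i : Fin k) :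
    v i * M.Psi θ φ₀ i = 0 := by
  have h1 := hle θ hθ.1.1
  rw [supportFn_eq_of_mem hθ] at h1
  have h2 : ∀ j ∈ Finset.univ, v j * M.Psi θ φ₀ j ≤ 0 := fun j _ =>
    mul_nonpos_of_nonneg_of_nonpos (hv j) (hθ.1.2 j)
  have h3 : ∑ j, v j * M.Psi θ φ₀ j = 0 := le_antisymm (Finset.sum_nonpos h2) (by linarith)
  exact (Finset.sum_eq_zero_iff_of_nonpos h2).1 h3 i (Finset.mem_univ i)

/-- The first-order condition in the Lagrangian. -/
lemma eq_sum_gradTheta (H : M.LocalConditions φ₀ lam δ) {ν : USphere d} {θ : Euc d}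
    (hθ : θ ∈ M.supportSet ν φ₀) {v : Euc k} (hv : ∀ i, 0 ≤ v i) (hle : ∀ θ' ∈ M.Theta,
      ⟪(ν : Euc d), θ'⟫_ℝ - ∑ i, v i * M.Psi θ' φ₀ i ≤ M.supportFn φ₀ ν) :
    (ν : Euc d) = ∑ i, v i • M.gradTheta i θ φ₀ := by
  have hz := mul_Psi_eq_zero hθ hv hle
  have hder : ∀ i, HasFDerivAt (fun θ' => v i * M.Psi θ' φ₀ i)
      (v i • innerSL ℝ (M.gradTheta i θ φ₀)) θ := by
    intro i
    -- Differentiability is available only for constraints active somewhere on Θ(φ₀); slackness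
    -- removes the others.
    rcases mul_eq_zero.1 (hz i) with h0 | h0
    · simpa [h0] using hasFDerivAt_const (0 : ℝ) θ
    · have h1 := H.reg.differentiable_theta i ⟨θ, hθ.1, h0⟩ φ₀ H.mem_nbhd_self θ hθ.1
      exact h1.hasGradientAt.hasFDerivAt.const_mul (v i)
  have hder2 : HasFDerivAt (fun θ' => ⟪(ν : Euc d), θ'⟫_ℝ - ∑ i, v i * M.Psi θ' φ₀ i)
      (innerSL ℝ (ν : Euc d) - ∑ i, v i • innerSL ℝ (M.gradTheta i θ φ₀)) θ := by
    refine HasFDerivAt.sub (innerSL ℝ (ν : Euc d)).hasFDerivAt ?_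
    exact HasFDerivAt.fun_sum fun i _ => hder i
  have hmax : IsLocalMax (fun θ' => ⟪(ν : Euc d), θ'⟫_ℝ - ∑ i, v i * M.Psi θ' φ₀ i) θ := by
    have h1 := H.reg.subset_interior φ₀ H.mem_nbhd_self hθ.1
    filter_upwards [mem_interior_iff_mem_nhds.1 h1] with θ' hθ'
    have h2 : ∑ i, v i * M.Psi θ φ₀ i = 0 := Finset.sum_eq_zero fun i _ => hz i
    rw [h2, sub_zero, ← supportFn_eq_of_mem hθ]
    exact hle θ' hθ'
  have h0 := hmax.hasFDerivAt_eq_zero hder2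
  refine ext_inner_right ℝ fun x => ?_
  have h1 := congrArg (fun L : Euc d →L[ℝ] ℝ => L x) h0
  simp only [sub_apply, sum_apply, smul_apply, innerSL_apply_apply,
    zero_apply, smul_eq_mul] at h1
  simp only [sum_inner, inner_smul_left]
  simpa [sub_eq_zero] using h1

/-- The multipliers at the true value are unique. -/
lemma eq_lam (H : M.LocalConditions φ₀ lam δ) (ν : USphere d) {v : Euc k} (hv : ∀ i, 0 ≤ v i)
    (hle : ∀ θ' ∈ M.Theta,
      ⟪(ν : Euc d), θ'⟫_ℝ - ∑ i, v i * M.Psi θ' φ₀ i ≤ M.supportFn φ₀ ν) : v = lam ν φ₀ := by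
  obtain ⟨θ, hθ⟩ := H.exists_mem_supportSet H.mem_nbhd_self ν
  have hlam0 := (H.mult ν φ₀ H.mem_nbhd_self).1
  have hlamle := fun θ' hθ' => H.inner_sub_le_supportFn H.mem_nbhd_self ν (θ := θ') hθ'
  -- Both multiplier vectors represent ν at the same maximiser and vanish off its active set, so
  -- linear independence identifies them.
  have h1 := H.eq_sum_gradTheta hθ hv hle
  have h2 := H.eq_sum_gradTheta hθ hlam0 hlamle
  have h3 : ∑ i, (v i - lam ν φ₀ i) • M.gradTheta i θ φ₀ = 0 := by
    simp only [sub_smul, Finset.sum_sub_distrib]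
    rw [← h1, ← h2, sub_self]
  have hzero : ∀ i, i ∉ M.active θ φ₀ → v i - lam ν φ₀ i = 0 := by
    intro i hi
    have h4 : M.Psi θ φ₀ i ≠ 0 := hi
    rw [(mul_eq_zero.1 (mul_Psi_eq_zero hθ hv hle i)).resolve_right h4,
      (mul_eq_zero.1 (mul_Psi_eq_zero hθ hlam0 hlamle i)).resolve_right h4, sub_zero]
  classical
  have h5 : ∑ i : M.active θ φ₀, (v i - lam ν φ₀ i) • M.gradTheta (i : Fin k) θ φ₀ = 0 := by
    have h6 : ∑ i with i ∈ M.active θ φ₀, (v i - lam ν φ₀ i) • M.gradTheta i θ φ₀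
        = ∑ i : M.active θ φ₀, (v i - lam ν φ₀ i) • M.gradTheta (i : Fin k) θ φ₀ :=
      Finset.sum_subtype _ (by simp) _
    rw [Finset.sum_filter_of_ne, h3] at h6
    · exact h6.symm
    · intro i _ hi
      by_contra hcon
      exact hi (by rw [hzero i hcon, zero_smul])
  have h6 := Fintype.linearIndependent_iff.1 (H.indep θ hθ.1) (fun i => v i - lam ν φ₀ i) h5
  ext i
  by_cases hi : i ∈ M.active θ φ₀
  · exact sub_eq_zero.1 (h6 ⟨i, hi⟩)
  · exact sub_eq_zero.1 (hzero i hi)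

/-- The multipliers at the true value are continuous in the direction. -/
lemma tendsto_lam (H : M.LocalConditions φ₀ lam δ) {ν : ℕ → USphere d} {ν₀ : USphere d}
    (hν : Tendsto ν atTop (𝓝 ν₀)) : Tendsto (fun j => lam (ν j) φ₀) atTop (𝓝 (lam ν₀ φ₀)) := by
  obtain ⟨B, -, hB⟩ := H.exists_norm_lam_le
  choose θ hθ using fun j => H.exists_mem_supportSet H.mem_nbhd_self (ν j)
  -- The multipliers are bounded, and every subsequential limit is again a multiplier vector, hence
  -- the unique one.
  refine tendsto_of_subseq_tendsto fun ns hns => ?_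
  obtain ⟨⟨v, y⟩, -, ms, hms, hlim⟩ :=
    ((isCompact_closedBall (0 : Euc k) B).prod H.param.compact).tendsto_subseq
      (x := fun j => (lam (ν (ns j)) φ₀, θ (ns j)))
      fun j => ⟨by simpa using hB _, (hθ _).1.1⟩
  have hv := (continuous_fst.tendsto _).comp hlim
  have hy := (continuous_snd.tendsto _).comp hlim
  have hν2 : Tendsto (fun j => ν (ns (ms j))) atTop (𝓝 ν₀) :=
    hν.comp (hns.comp hms.tendsto_atTop)
  have hν' : Tendsto (fun j => (ν (ns (ms j)) : Euc d)) atTop (𝓝 (ν₀ : Euc d)) :=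
    (continuous_subtype_val.tendsto _).comp hν2
  have hvi : ∀ i, Tendsto (fun j => lam (ν (ns (ms j))) φ₀ i) atTop (𝓝 (v i)) := fun i =>
    ((EuclideanSpace.proj (𝕜 := ℝ) i).continuous.tendsto _).comp hv
  have hmem := H.mem_supportSet_of_tendsto hν2 tendsto_const_nhds hy fun j => hθ _
  refine ⟨ms, ?_⟩
  have heq : v = lam ν₀ φ₀ := by
    refine H.eq_lam ν₀ (fun i => ge_of_tendsto' (hvi i) fun j =>
      (H.mult _ φ₀ H.mem_nbhd_self).1 i) fun θ' hθ' => ?_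
    rw [supportFn_eq_of_mem hmem]
    refine le_of_tendsto_of_tendsto' ((hν'.inner tendsto_const_nhds).sub
      (tendsto_finsetSum _ fun i _ => (hvi i).mul_const _)) (hν'.inner hy) fun j => ?_
    refine (H.inner_sub_le_supportFn H.mem_nbhd_self _ hθ').trans_eq ?_
    exact supportFn_eq_of_mem (hθ _)
  rw [← heq]
  exact hv

lemma tendsto_jac (H : M.LocalConditions φ₀ lam δ) {θ : ℕ → Euc d} {θ₀ : Euc d}
    (hθ : Tendsto θ atTop (𝓝 θ₀)) (hmem : ∀ j, θ j ∈ M.Theta) :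
    Tendsto (fun j => M.jac (θ j) φ₀) atTop (𝓝 (M.jac θ₀ φ₀)) := by
  have hθ₀ : θ₀ ∈ M.Theta :=
    H.param.compact.isClosed.mem_of_tendsto hθ (Eventually.of_forall hmem)
  have h1 := H.reg.continuous_jac (θ₀, φ₀) ⟨hθ₀, H.mem_nbhd_self⟩
  exact h1.tendsto.comp (tendsto_nhdsWithin_iff.2 ⟨hθ.prodMk_nhds tendsto_const_nhds,
    Eventually.of_forall fun j => ⟨hmem j, H.mem_nbhd_self⟩⟩)

lemma tendsto_lagrangeGrad (H : M.LocalConditions φ₀ lam δ) {ν : ℕ → USphere d} {ν₀ : USphere d}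
    {θ : ℕ → Euc d} {θ₀ : Euc d} (hν : Tendsto ν atTop (𝓝 ν₀)) (hθ : Tendsto θ atTop (𝓝 θ₀))
    (hmem : ∀ j, θ j ∈ M.Theta) :
    Tendsto (fun j => M.lagrangeGrad lam φ₀ (ν j) (θ j)) atTop
      (𝓝 (M.lagrangeGrad lam φ₀ ν₀ θ₀)) := by
  have h1 : Continuous fun z : Euc k × Matrix (Fin k) (Fin p) ℝ =>
      (WithLp.toLp 2 (z.1.ofLp ᵥ* z.2) : Euc p) := by
    refine (PiLp.continuous_toLp 2 _).comp ?_
    exact Continuous.matrix_vecMul (by fun_prop) continuous_snd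
  exact (h1.tendsto _).comp ((H.tendsto_lam hν).prodMk_nhds (H.tendsto_jac hθ hmem))

end LocalConditions
end MomentModel

/-! ### First-order terms at non-unique maximisers -/

namespace MomentModel

variable {d p k : ℕ} {M : MomentModel d p k} {φ₀ : Euc p} {lam : USphere d → Euc p → Euc k} {δ : ℝ}

namespace LocalConditions

/-- For a constraint that is affine in `θ` at the true value, its derivatives in `φ` are convex
in `θ`. -/
lemma convexOn_jac_mulVec (H : M.LocalConditions φ₀ lam δ) {i : Fin k}
    (hi : ConcaveOn ℝ M.Theta fun θ => M.Psi θ φ₀ i) (h : Euc p) :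
    ConvexOn ℝ M.Theta fun θ => (M.jac θ φ₀ *ᵥ h.ofLp) i := by
  have hlim : ∀ θ ∈ M.Theta, Tendsto
      (fun t : ℝ => t⁻¹ * (M.Psi θ (φ₀ + t • h) i - M.Psi θ φ₀ i)) (𝓝[>] 0)
      (𝓝 ((M.jac θ φ₀ *ᵥ h.ofLp) i)) := by
    intro θ hθ
    have h1 := (H.reg.differentiable_phi θ hθ φ₀ H.mem_nbhd_self i).hasFDerivAt
    have h2 := (h1.hasLineDerivAt h).tendsto_slope_zero_right
    rw [fderiv_eq_jac] at h2
    simpa using h2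
  -- For small `t > 0` the difference quotient is a convex function of θ minus a concave one,
  -- divided by `t`; its convexity passes to the limit.
  refine ⟨H.param.convex, fun x hx y hy a b ha hb hab => ?_⟩
  have hz := H.param.convex hx hy ha hb hab
  refine le_of_tendsto_of_tendsto (hlim _ hz)
    (((hlim x hx).const_mul a).add ((hlim y hy).const_mul b)) ?_
  have hΦ : ∀ᶠ t : ℝ in 𝓝[>] 0, φ₀ + t • h ∈ M.Phi := by
    have hc : Tendsto (fun t : ℝ => φ₀ + t • h) (𝓝 0) (𝓝 (φ₀ + (0 : ℝ) • h)) :=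
      Continuous.tendsto (by fun_prop) 0
    rw [zero_smul, add_zero] at hc
    exact (hc.eventually (mem_interior_iff_mem_nhds.1 H.param.mem_interior)).filter_mono
      nhdsWithin_le_nhds
  filter_upwards [hΦ, self_mem_nhdsWithin] with t ht (ht0 : 0 < t)
  have h1 := (H.conv.convexOn _ ht i).2 hx hy ha hb hab
  have h2 := hi.2 hx hy ha hb hab
  simp only [smul_eq_mul] at h1 h2 ⊢
  have h3 := mul_le_mul_of_nonneg_left (sub_le_sub h1 h2) (inv_pos.2 ht0).le
  refine h3.trans_eq ?_
  ring

/-- The first-order term at an arbitrary maximiser is controlled by the first-order terms at the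
directions with a unique maximiser. -/
lemma inner_lagrangeGrad_le (H : M.LocalConditions φ₀ lam δ) {h : Euc p} {c : ℝ}
    (hc : ∀ ν θ, M.supportSet ν φ₀ = {θ} → ⟪M.lagrangeGrad lam φ₀ ν θ, h⟫_ℝ ≤ c)
    {ν : USphere d} {θ : Euc d} (hθ : θ ∈ M.supportSet ν φ₀) :
    ⟪M.lagrangeGrad lam φ₀ ν θ, h⟫_ℝ ≤ c := by
  rcases H.lin with hsing | ⟨L, -, hstrict, A₁, A₂, hL⟩
  · obtain ⟨θ', hθ'⟩ := hsing ν φ₀ H.mem_nbhd_self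
    obtain rfl : θ = θ' := by simpa [hθ'] using hθ
    exact hc ν θ hθ'
  by_cases hsub : M.supportSet ν φ₀ ⊆ {θ}
  · exact hc ν θ (hsub.antisymm (singleton_subset_iff.2 hθ))
  obtain ⟨θ', hθ', hne⟩ := not_subset.1 hsub
  have hne : θ ≠ θ' := fun h0 => hne h0.symm
  have hlam0 := (H.mult ν φ₀ H.mem_nbhd_self).1
  have hlamle := fun θ' hθ' => H.inner_sub_le_supportFn H.mem_nbhd_self ν (θ := θ') hθ'
  -- A constraint with nonzero multiplier vanishes on the whole support set, which contains the
  -- midpoint of `θ` and `θ'`; strict convexity forbids this.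
  have hoff : ∀ i, i ∉ L → lam ν φ₀ i = 0 := by
    intro i hi
    by_contra hpos
    have hzero : ∀ x ∈ M.supportSet ν φ₀, M.Psi x φ₀ i = 0 := fun x hx =>
      (mul_eq_zero.1 (mul_Psi_eq_zero hx hlam0 hlamle i)).resolve_left hpos
    have hmid : (1 / 2 : ℝ) • θ + (1 / 2 : ℝ) • θ' ∈ M.supportSet ν φ₀ := by
      refine ⟨convex_identSet H.conv H.param H.mem_nbhd_self.1 hθ.1 hθ'.1 (by norm_num)
        (by norm_num) (by norm_num), fun z hz => ?_⟩
      rw [inner_add_right, inner_smul_right, inner_smul_right]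
      have h1 := hθ.2 z hz
      have h2 := hθ'.2 z hz
      linarith
    have h1 : M.Psi ((1 / 2 : ℝ) • θ + (1 / 2 : ℝ) • θ') φ₀ i
        < (1 / 2 : ℝ) • M.Psi θ φ₀ i + (1 / 2 : ℝ) • M.Psi θ' φ₀ i :=
      (hstrict i hi).2 hθ.1.1 hθ'.1.1 hne (by norm_num) (by norm_num) (by norm_num)
    simp only [hzero _ hθ, hzero _ hθ', hzero _ hmid, smul_zero, add_zero, lt_irrefl] at h1
  set f : Euc d → ℝ := fun x => ⟪M.lagrangeGrad lam φ₀ ν x, h⟫_ℝ with hf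
  have hfeq : ∀ x, f x = ∑ i ∈ L, lam ν φ₀ i * (M.jac x φ₀ *ᵥ h.ofLp) i := by
    intro x
    rw [hf]
    simp only [lagrangeGrad, inner_vecMul]
    refine (Finset.sum_subset (Finset.subset_univ L) fun i _ hi => ?_).symm
    rw [hoff i hi, zero_mul]
  have hconv : ConvexOn ℝ M.Theta f := by
    have h1 : ∀ i ∈ L, ConvexOn ℝ M.Theta
        fun x => lam ν φ₀ i * (M.jac x φ₀ *ᵥ h.ofLp) i := by
      intro i hi
      have h2 : ConcaveOn ℝ M.Theta fun x => M.Psi x φ₀ i := by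
        refine ⟨H.param.convex, fun x hx y hy a b ha hb hab => le_of_eq ?_⟩
        have h3 := hL _ (H.param.convex hx hy ha hb hab) ⟨i, hi⟩
        have h4 := hL x hx ⟨i, hi⟩
        have h5 := hL y hy ⟨i, hi⟩
        simp only at h3 h4 h5
        simp only [smul_eq_mul]
        rw [h3, h4, h5]
        simp only [WithLp.ofLp_add, WithLp.ofLp_smul, Matrix.mulVec_add, Matrix.mulVec_smul,
          Pi.add_apply, Pi.smul_apply, smul_eq_mul]
        linear_combination (A₂ φ₀ ⟨i, hi⟩) * hab
      simpa using (H.convexOn_jac_mulVec h2 h).smul (hlam0 i)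
    refine ⟨H.param.convex, fun x hx y hy a b ha hb hab => ?_⟩
    rw [hfeq, hfeq, hfeq, smul_eq_mul, smul_eq_mul, Finset.mul_sum, Finset.mul_sum,
      ← Finset.sum_add_distrib]
    exact Finset.sum_le_sum fun i hi => (h1 i hi).2 hx hy ha hb hab
  have hcont : ContinuousOn f M.Theta := by
    have h1 : ContinuousOn (fun x => M.jac x φ₀) M.Theta :=
      H.reg.continuous_jac.comp (f := fun x => (x, φ₀)) (by fun_prop)
        fun x hx => ⟨hx, H.mem_nbhd_self⟩
    have h2 : Continuous fun A : Matrix (Fin k) (Fin p) ℝ =>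
        ⟪(WithLp.toLp 2 ((lam ν φ₀).ofLp ᵥ* A) : Euc p), h⟫_ℝ := by
      refine Continuous.inner ((PiLp.continuous_toLp 2 _).comp ?_) continuous_const
      exact Continuous.matrix_vecMul continuous_const continuous_id
    exact h2.comp_continuousOn h1
  -- Take an affine minorant of `f` within ε at `θ`, and tilt ν along its linear part. The limit `y`
  -- of unique maximisers satisfies `l θ ≤ l y`, so `f θ - ε ≤ f y`, while `f y ≤ c` by continuity.
  refine le_of_forall_pos_sub_le fun ε hε => ?_
  obtain ⟨l, c', hle, hval⟩ := ConvexOn.exists_affine_le_of_lt (𝕜 := ℝ) (φ := f) (a := f θ - ε)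
    hθ.1.1 (by linarith) H.param.compact.isClosed hcont.lowerSemicontinuousOn hconv
  have hl : ∀ x, l x = ⟪(InnerProductSpace.toDual ℝ (Euc d)).symm l, x⟫_ℝ := fun x => by
    rw [InnerProductSpace.toDual_symm_apply]
  have hcomp : IsCompact (M.identSet φ₀) := H.param.compact.of_isClosed_subset
    (isClosed_identSet H.conv H.param H.mem_nbhd_self.1) fun θ h => h.1
  obtain ⟨u, x, y, hu, hx, hxC, hxu, hm⟩ := exists_seq_unique_maximiser hcomp ν
    ((InnerProductSpace.toDual ℝ (Euc d)).symm l) hθ.1 hθ.2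
  rw [← hl, ← hl] at hm
  have hsing : ∀ j, M.supportSet (u j) φ₀ = {x j} := by
    intro j
    ext z
    constructor
    · intro hz
      by_contra hne
      exact absurd (hz.2 _ (hxC j)) (not_le.2 (hxu j z hz.1 hne))
    · rintro rfl
      refine ⟨hxC j, fun z hz => ?_⟩
      rcases eq_or_ne z (x j) with rfl | hne
      · exact le_rfl
      · exact (hxu j z hz hne).le
  have hlim : Tendsto (fun j => ⟪M.lagrangeGrad lam φ₀ (u j) (x j), h⟫_ℝ) atTop (𝓝 (f y)) :=
    (H.tendsto_lagrangeGrad hu hx fun j => (hxC j).1).inner tendsto_const_nhds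
  have hfy : f y ≤ c := le_of_tendsto' hlim fun j => hc _ _ (hsing j)
  have hy : y ∈ M.Theta :=
    H.param.compact.isClosed.mem_of_tendsto hx (Eventually.of_forall fun j => (hxC j).1)
  have h1 := hle ⟨y, hy⟩
  simp at h1 hval
  linarith

lemma exists_norm_lagrangeGrad_le (H : M.LocalConditions φ₀ lam δ) :
    ∃ B, ∀ ν, ∀ θ ∈ M.Theta, ‖M.lagrangeGrad lam φ₀ ν θ‖ ≤ B := by
  obtain ⟨B, hB0, hB⟩ := H.exists_norm_lam_le
  obtain ⟨J, hJ0, hJ⟩ := H.exists_frobNorm_jac_le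
  exact ⟨B * J, fun ν θ hθ => (norm_vecMul_le _ _).trans
    (mul_le_mul (hB ν) (hJ θ hθ) (frobNorm_nonneg _) hB0)⟩

end LocalConditions
end MomentModel

/-- The supremum of the absolute values of a bounded family of linear functionals. -/
lemma exists_seminorm_of_bounded {m : ℕ} {A : Set (Euc m)} {B : ℝ} (hB : ∀ a ∈ A, ‖a‖ ≤ B) :
    ∃ G : Seminorm ℝ (Euc m), Continuous G ∧ (∀ a ∈ A, ∀ h, |⟪a, h⟫_ℝ| ≤ G h) ∧
      ∀ h c, 0 ≤ c → (∀ a ∈ A, |⟪a, h⟫_ℝ| ≤ c) → G h ≤ c := by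
  have hbdd : ∀ h : Euc m, BddAbove (range fun a : A => |⟪(a : Euc m), h⟫_ℝ|) := by
    intro h
    refine ⟨B * ‖h‖, ?_⟩
    rintro _ ⟨a, rfl⟩
    refine (abs_real_inner_le_norm _ _).trans ?_
    gcongr
    exact hB a a.2
  have hle : ∀ (a : A) h, |⟪(a : Euc m), h⟫_ℝ| ≤ ⨆ a : A, |⟪(a : Euc m), h⟫_ℝ| := fun a h =>
    le_ciSup (hbdd h) a
  have hnn : ∀ h, 0 ≤ ⨆ a : A, |⟪(a : Euc m), h⟫_ℝ| := fun h =>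
    Real.iSup_nonneg fun a => abs_nonneg _
  let G : Seminorm ℝ (Euc m) := Seminorm.ofSMulLE (fun h => ⨆ a : A, |⟪(a : Euc m), h⟫_ℝ|)
    (by simp)
    (fun x y => Real.iSup_le (fun a => by
      rw [inner_add_right]
      exact (abs_add_le _ _).trans (add_le_add (hle a x) (hle a y)))
      (add_nonneg (hnn x) (hnn y)))
    (fun r x => Real.iSup_le (fun a => by
      rw [inner_smul_right, abs_mul, Real.norm_eq_abs]
      exact mul_le_mul_of_nonneg_left (hle a x) (abs_nonneg r))
      (mul_nonneg (norm_nonneg _) (hnn x)))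
  refine ⟨G, ?_, fun a ha h => hle ⟨a, ha⟩ h, fun h c hc hA => Real.iSup_le (fun a => hA a a.2) hc⟩
  -- `B` may be negative when `A` is empty, hence its positive part.
  refine Seminorm.continuous_of_le (q := (Real.toNNReal B) • normSeminorm ℝ (Euc m)) ?_ fun h => ?_
  · exact (continuous_const.mul continuous_norm)
  · refine Real.iSup_le (fun a => (abs_real_inner_le_norm _ _).trans ?_) (by positivity)
    change _ ≤ (Real.toNNReal B : ℝ) * ‖h‖
    gcongr
    exact (hB a a.2).trans (Real.le_coe_toNNReal B)

/-! ### Uniform comparison of support functions with a seminorm -/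

namespace MomentModel

variable {d p k : ℕ} {M : MomentModel d p k} {φ₀ : Euc p} {lam : USphere d → Euc p → Euc k} {δ : ℝ}

namespace LocalConditions

lemma tendsto_of_forall_norm_le_inv {x : ℕ → Euc p} (hx : ∀ j : ℕ, ‖x j - φ₀‖ ≤ ((j : ℝ) + 1)⁻¹) :
    Tendsto x atTop (𝓝 φ₀) := by
  rw [tendsto_iff_norm_sub_tendsto_zero]
  refine squeeze_zero (fun j => norm_nonneg _) hx ?_
  simpa using tendsto_one_div_add_atTop_nhds_zero_nat (𝕜 := ℝ)

/-- The first-order terms at maximisers for parameters near the true value. -/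
lemma exists_abs_inner_lagrangeGrad_le (H : M.LocalConditions φ₀ lam δ) {G : Seminorm ℝ (Euc p)}
    (hGc : Continuous G) (hG : ∀ ν, ∀ θ ∈ M.supportSet ν φ₀, ∀ h,
      |⟪M.lagrangeGrad lam φ₀ ν θ, h⟫_ℝ| ≤ G h) {ε : ℝ} (hε : 0 < ε) :
    ∃ r, 0 < r ∧ ∀ φ ∈ closedBall φ₀ r, ∀ ν, ∀ θ ∈ M.supportSet ν φ, ∀ h,
      |⟪M.lagrangeGrad lam φ₀ ν θ, h⟫_ℝ| ≤ G h + ε * ‖h‖ := by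
  -- Compactness: a failure at radii `1 / (j + 1)`, with increments normalised by homogeneity, has a
  -- limit that violates `hG` at a maximiser for φ₀.
  by_contra hcon
  push Not at hcon
  choose φ hφ ν θ hθ h hh using fun j : ℕ => hcon ((j : ℝ) + 1)⁻¹ (by positivity)
  have hφ₀ : Tendsto φ atTop (𝓝 φ₀) := tendsto_of_forall_norm_le_inv fun j => by
    simpa [dist_eq_norm] using hφ j
  have hh0 : ∀ j, h j ≠ 0 := fun j h0 => by
    have := hh j
    simp [h0] at this
  set e : ℕ → Euc p := fun j => ‖h j‖⁻¹ • h j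
  have he : ∀ j, ‖e j‖ = 1 := fun j => norm_smul_inv_norm (𝕜 := ℝ) (hh0 j)
  have heh : ∀ j, G (e j) + ε < |⟪M.lagrangeGrad lam φ₀ (ν j) (θ j), e j⟫_ℝ| := by
    intro j
    have hpos : 0 < ‖h j‖⁻¹ := inv_pos.2 (norm_pos_iff.2 (hh0 j))
    rw [inner_smul_right, abs_mul, map_smul_eq_mul, Real.norm_of_nonneg hpos.le,
      abs_of_pos hpos]
    have h1 := mul_lt_mul_of_pos_left (hh j) hpos
    have h2 : ‖h j‖⁻¹ * ‖h j‖ = 1 := inv_mul_cancel₀ (norm_ne_zero_iff.2 (hh0 j))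
    nlinarith
  obtain ⟨⟨ν', θ', e'⟩, -, ms, hms, hlim⟩ :=
    (isCompact_univ.prod (H.param.compact.prod (isCompact_closedBall (0 : Euc p) 1))).tendsto_subseq
      (x := fun j => (ν j, θ j, e j))
      fun j => ⟨mem_univ _, (hθ j).1.1, by simp [he]⟩
  have hν' := (continuous_fst.tendsto _).comp hlim
  have hθ' := ((continuous_fst.comp continuous_snd).tendsto _).comp hlim
  have he' := ((continuous_snd.comp continuous_snd).tendsto _).comp hlim
  have hmem := H.mem_supportSet_of_tendsto hν' (hφ₀.comp hms.tendsto_atTop) hθ' fun j => hθ _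
  have h1 := (H.tendsto_lagrangeGrad hν' hθ' fun j => (hθ _).1.1)
  have h2 := (Filter.Tendsto.inner (𝕜 := ℝ) h1 he').abs
  have h3 := ((hGc.tendsto _).comp he').add_const ε
  have h4 := le_of_tendsto_of_tendsto' h3 h2 fun j => (heh _).le
  have h5 := hG _ _ hmem e'
  simp only [Function.comp_def] at h4 h5
  linarith

/-- Near the true value the support function is, in the direction of a unique maximiser, strictly
differentiable. -/
lemma exists_abs_supportFn_sub_sub_le (H : M.LocalConditions φ₀ lam δ) {ν : USphere d}
    {θ : Euc d} (hsing : M.supportSet ν φ₀ = {θ}) {ε : ℝ} (hε : 0 < ε) :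
    ∃ r, 0 < r ∧ ∀ φ₁ ∈ closedBall φ₀ r, ∀ φ₂ ∈ closedBall φ₀ r,
      |M.supportFn φ₁ ν - M.supportFn φ₂ ν + ⟪M.lagrangeGrad lam φ₀ ν θ, φ₁ - φ₂⟫_ℝ|
        ≤ ε * ‖φ₁ - φ₂‖ := by
  obtain ⟨r₁, hr₁, hr₁s, hexp⟩ := H.exists_supportFn_sub_le (half_pos hε)
  -- By the closed graph and uniqueness at φ₀, all maximisers for nearby φ are close to `θ`.
  obtain ⟨r₂, hr₂, hgrad⟩ : ∃ r, 0 < r ∧ ∀ φ ∈ closedBall φ₀ r, ∀ θ' ∈ M.supportSet ν φ,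
      ‖M.lagrangeGrad lam φ₀ ν θ' - M.lagrangeGrad lam φ₀ ν θ‖ ≤ ε / 2 := by
    by_contra hcon
    push Not at hcon
    choose φ hφ θ' hθ' hlt using fun j : ℕ => hcon ((j : ℝ) + 1)⁻¹ (by positivity)
    have hφ₀ : Tendsto φ atTop (𝓝 φ₀) := tendsto_of_forall_norm_le_inv fun j => by
      simpa [dist_eq_norm] using hφ j
    obtain ⟨y, -, ms, hms, hy⟩ := H.param.compact.tendsto_subseq fun j => (hθ' j).1.1
    have hmem := H.mem_supportSet_of_tendsto (tendsto_const_nhds (x := ν))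
      (hφ₀.comp hms.tendsto_atTop) hy fun j => hθ' _
    obtain rfl : y = θ := by simpa [hsing] using hmem
    have h1 := H.tendsto_lagrangeGrad (tendsto_const_nhds (x := ν)) hy fun j => (hθ' _).1.1
    have h2 := (h1.sub_const (M.lagrangeGrad lam φ₀ ν y)).norm
    rw [sub_self, norm_zero] at h2
    have h3 := ge_of_tendsto' h2 fun j => (hlt (ms j)).le
    linarith
  refine ⟨min r₁ r₂, lt_min hr₁ hr₂, ?_⟩
  have hone : ∀ φ₁ ∈ closedBall φ₀ (min r₁ r₂), ∀ φ₂ ∈ closedBall φ₀ (min r₁ r₂),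
      M.supportFn φ₁ ν - M.supportFn φ₂ ν + ⟪M.lagrangeGrad lam φ₀ ν θ, φ₁ - φ₂⟫_ℝ
        ≤ ε * ‖φ₁ - φ₂‖ := by
    intro φ₁ h₁ φ₂ h₂
    have h₁' := closedBall_subset_closedBall (min_le_left r₁ r₂) h₁
    have h₂' := closedBall_subset_closedBall (min_le_left r₁ r₂) h₂
    obtain ⟨θ', hθ'⟩ := H.exists_mem_supportSet (hr₁s h₁') ν
    have h3 := hexp φ₁ h₁' φ₂ h₂' ν θ' hθ'
    have h4 := hgrad φ₁ (closedBall_subset_closedBall (min_le_right r₁ r₂) h₁) θ' hθ'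
    have h5 := abs_real_inner_le_norm
      (M.lagrangeGrad lam φ₀ ν θ' - M.lagrangeGrad lam φ₀ ν θ) (φ₁ - φ₂)
    have h6 := h5.trans (mul_le_mul_of_nonneg_right h4 (norm_nonneg _))
    rw [inner_sub_left] at h6
    have h7 := (abs_le.1 h6).1
    linarith
  intro φ₁ h₁ φ₂ h₂
  refine abs_le.2 ⟨?_, hone φ₁ h₁ φ₂ h₂⟩
  have h3 := hone φ₂ h₂ φ₁ h₁
  rw [← neg_sub φ₁ φ₂, inner_neg_right, norm_neg] at h3
  linarith

/-- Uniform first-order comparison of the support functions near the true value with a seminorm. -/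
theorem exists_seminorm (H : M.LocalConditions φ₀ lam δ) (hnd : M.Nondegenerate φ₀ lam) :
    ∃ G : Seminorm ℝ (Euc p), Continuous G ∧ (∃ u, G u ≠ 0) ∧ ∀ ε > 0, ∃ r > 0,
      (∀ φ ∈ closedBall φ₀ r, ∀ ν,
        |M.supportFn φ₀ ν - M.supportFn φ ν| ≤ G (φ - φ₀) + ε * ‖φ - φ₀‖) ∧
      ∀ φ₁ ∈ closedBall φ₀ r, ∀ φ₂ ∈ closedBall φ₀ r,
        G (φ₁ - φ₂) - ε * ‖φ₁ - φ₂‖ ≤ ⨆ ν, |M.supportFn φ₁ ν - M.supportFn φ₂ ν| := by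
  obtain ⟨B, hB⟩ := H.exists_norm_lagrangeGrad_le
  set A : Set (Euc p) := {a | ∃ ν θ, M.supportSet ν φ₀ = {θ} ∧ a = M.lagrangeGrad lam φ₀ ν θ}
  have hAB : ∀ a ∈ A, ‖a‖ ≤ B := by
    rintro _ ⟨ν, θ, hsing, rfl⟩
    have hθ : θ ∈ M.supportSet ν φ₀ := by simp [hsing]
    exact hB ν θ hθ.1.1
  obtain ⟨G, hGc, hGA, hGle⟩ := exists_seminorm_of_bounded hAB
  have hGall : ∀ ν, ∀ θ ∈ M.supportSet ν φ₀, ∀ h,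
      |⟪M.lagrangeGrad lam φ₀ ν θ, h⟫_ℝ| ≤ G h := by
    intro ν θ hθ h
    -- The one-sided comparison is applied to `h` and to `-h`.
    refine abs_le'.2 ⟨H.inner_lagrangeGrad_le (fun ν' θ' hs => ?_) hθ, ?_⟩
    · exact (le_abs_self _).trans (hGA _ ⟨ν', θ', hs, rfl⟩ h)
    · rw [← inner_neg_right]
      refine H.inner_lagrangeGrad_le (fun ν' θ' hs => ?_) hθ
      rw [inner_neg_right]
      exact (neg_le_abs _).trans (hGA _ ⟨ν', θ', hs, rfl⟩ h)
  refine ⟨G, hGc, ?_, fun ε hε => ?_⟩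
  · obtain ⟨ν, θ, hθ, hne⟩ := hnd
    refine ⟨M.lagrangeGrad lam φ₀ ν θ, fun h0 => hne ?_⟩
    have h1 := hGall ν θ hθ (M.lagrangeGrad lam φ₀ ν θ)
    rw [h0, abs_nonpos_iff, inner_self_eq_zero] at h1
    exact congrArg WithLp.ofLp h1
  · have hε2 := half_pos hε
    obtain ⟨r₁, hr₁, hr₁s, hexp⟩ := H.exists_supportFn_sub_le hε2
    obtain ⟨r₂, hr₂, hgrad⟩ := H.exists_abs_inner_lagrangeGrad_le hGc hGall hε2
    have hAtb : TotallyBounded A :=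
      ((isCompact_closedBall (0 : Euc p) B).totallyBounded).subset fun a ha => by
        simpa using hAB a ha
    -- The radius of strict differentiability depends on the direction; a finite net of gradients
    -- gives a common one.
    obtain ⟨T, hTA, hTfin, hT⟩ := Metric.finite_approx_of_totallyBounded hAtb (ε / 2) hε2
    have hTr : ∀ a : T, ∃ r, 0 < r ∧ ∃ ν : USphere d, ∀ φ₁ ∈ closedBall φ₀ r,
        ∀ φ₂ ∈ closedBall φ₀ r,
        |M.supportFn φ₁ ν - M.supportFn φ₂ ν + ⟪(a : Euc p), φ₁ - φ₂⟫_ℝ|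
          ≤ ε / 2 * ‖φ₁ - φ₂‖ := by
      rintro ⟨a, ha⟩
      obtain ⟨ν, θ, hs, rfl⟩ := hTA ha
      obtain ⟨r, hr, h1⟩ := H.exists_abs_supportFn_sub_sub_le hs hε2
      exact ⟨r, hr, ν, h1⟩
    choose ρ hρ ν hν using hTr
    have := hTfin.fintype
    obtain ⟨r₃, hr₃, hr₃le⟩ : ∃ r, 0 < r ∧ ∀ a, r ≤ ρ a := by
      rcases isEmpty_or_nonempty T with hE | hN
      · exact ⟨1, one_pos, fun a => hE.elim a⟩
      · obtain ⟨a, ha⟩ := Finite.exists_min ρ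
        exact ⟨ρ a, hρ a, ha⟩
    refine ⟨min r₁ (min r₂ r₃), lt_min hr₁ (lt_min hr₂ hr₃), ?_, ?_⟩
    · intro φ hφ ν
      have h₁ : φ ∈ closedBall φ₀ r₁ := closedBall_subset_closedBall (min_le_left _ _) hφ
      have h₂ : φ ∈ closedBall φ₀ r₂ := closedBall_subset_closedBall
        ((min_le_right _ _).trans (min_le_left _ _)) hφ
      have h₀ : φ₀ ∈ closedBall φ₀ r₁ := mem_closedBall_self hr₁.le
      obtain ⟨θ₀, hθ₀⟩ := H.exists_mem_supportSet H.mem_nbhd_self ν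
      obtain ⟨θ, hθ⟩ := H.exists_mem_supportSet (hr₁s h₁) ν
      -- One side of the bound uses a maximiser for φ, the other a maximiser for φ₀.
      have h3 := hexp φ h₁ φ₀ h₀ ν θ hθ
      have h4 := hexp φ₀ h₀ φ h₁ ν θ₀ hθ₀
      have h5 := hgrad φ h₂ ν θ hθ (φ - φ₀)
      have h6 := hGall ν θ₀ hθ₀ (φ - φ₀)
      rw [← neg_sub φ φ₀, inner_neg_right, norm_neg] at h4
      have h7 : 0 ≤ ε / 2 * ‖φ - φ₀‖ := by positivity
      rw [abs_le] at h5 h6 ⊢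
      constructor <;> linarith [h5.1, h6.2]
    · intro φ₁ h₁ φ₂ h₂
      have hs : min r₁ (min r₂ r₃) ≤ r₃ := (min_le_right _ _).trans (min_le_right _ _)
      rw [sub_le_iff_le_add]
      have hnn : 0 ≤ ⨆ ν, |M.supportFn φ₁ ν - M.supportFn φ₂ ν| :=
        Real.iSup_nonneg fun _ => abs_nonneg _
      refine hGle _ _ (by positivity) fun a ha => ?_
      obtain ⟨b, hb, hab⟩ := mem_iUnion₂.1 (hT ha)
      have hbr := closedBall_subset_closedBall (x := φ₀) (hs.trans (hr₃le ⟨b, hb⟩))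
      have h3 := hν ⟨b, hb⟩ φ₁ (hbr h₁) φ₂ (hbr h₂)
      have h4 := le_ciSup (bddAbove_supportFn_sub H.param φ₁ φ₂) (ν ⟨b, hb⟩)
      have h5 : |⟪a - b, φ₁ - φ₂⟫_ℝ| ≤ ε / 2 * ‖φ₁ - φ₂‖ := by
        refine (abs_real_inner_le_norm _ _).trans ?_
        gcongr
        rw [← dist_eq_norm]
        exact (mem_ball.1 hab).le
      rw [inner_sub_left] at h5
      simp only at h3 h4
      rw [abs_le] at h3 h5 ⊢
      have h6 := (abs_le.1 h4)
      constructor <;> linarith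

end LocalConditions
end MomentModel

/-- Quantitative separation of a point from a closed convex set. -/
lemma exists_separating_direction {d : ℕ} {C : Set (Euc d)} (hCc : IsClosed C)
    (hCv : Convex ℝ C) (hCn : C.Nonempty) {x : Euc d} (hx : x ∉ C) :
    ∃ ν : USphere d, ∃ y ∈ C, 0 < ‖x - y‖ ∧
      ∀ w ∈ C, ⟪(ν : Euc d), w⟫_ℝ + ‖x - y‖ ≤ ⟪(ν : Euc d), x⟫_ℝ := by
  obtain ⟨y, hy, hmin⟩ := exists_norm_eq_iInf_of_complete_convex hCn hCc.isComplete hCv x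
  have hle := (norm_eq_iInf_iff_real_inner_le_zero hCv hy).1 hmin
  have hne : x - y ≠ 0 := fun h0 => hx (by rwa [sub_eq_zero.1 h0])
  have hpos : 0 < ‖x - y‖ := norm_pos_iff.2 hne
  refine ⟨⟨‖x - y‖⁻¹ • (x - y), by
    rw [mem_sphere_zero_iff_norm]; exact norm_smul_inv_norm (𝕜 := ℝ) hne⟩, y, hy, hpos,
    fun w hw => ?_⟩
  have h1 := hle w hw
  have h2 : ⟪x - y, x - y⟫_ℝ = ‖x - y‖ ^ 2 := real_inner_self_eq_norm_sq _
  have h3 : ⟪x - y, w⟫_ℝ + ‖x - y‖ ^ 2 ≤ ⟪x - y, x⟫_ℝ := by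
    rw [inner_sub_right] at h1 h2
    linarith
  simp only [inner_smul_left, conj_trivial]
  have h4 := mul_le_mul_of_nonneg_left h3 (inv_pos.2 hpos).le
  have h5 : ‖x - y‖⁻¹ * ‖x - y‖ ^ 2 = ‖x - y‖ := by
    rw [sq, ← mul_assoc, inv_mul_cancel₀ hpos.ne', one_mul]
  rw [mul_add, h5] at h4
  exact h4

/-! ### From support functions to set inclusions -/

namespace MomentModel

variable {d p k : ℕ} {M : MomentModel d p k} {φ₀ : Euc p} {lam : USphere d → Euc p → Euc k} {δ : ℝ}

namespace LocalConditions

lemma inner_le_supportFn (H : M.LocalConditions φ₀ lam δ) {φ : Euc p} (hφ : φ ∈ M.nbhd φ₀ δ)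
    (ν : USphere d) {θ : Euc d} (hθ : θ ∈ M.identSet φ) :
    ⟪(ν : Euc d), θ⟫_ℝ ≤ M.supportFn φ ν := by
  obtain ⟨θ', hθ'⟩ := H.exists_mem_supportSet hφ ν
  rw [supportFn_eq_of_mem hθ']
  exact hθ'.2 θ hθ

/-- Identified sets with uniformly close support functions are close in both senses. -/
lemma contraction_subset_and_subset_envelope (H : M.LocalConditions φ₀ lam δ) {φ : Euc p}
    (hφ : φ ∈ M.nbhd φ₀ δ) {ε : ℝ} (hle : ∀ ν, |M.supportFn φ₀ ν - M.supportFn φ ν| ≤ ε) :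
    M.contraction (M.identSet φ) ε ⊆ M.identSet φ₀ ∧
      M.identSet φ₀ ⊆ M.envelope (M.identSet φ) ε := by
  have hcl := isClosed_identSet H.conv H.param hφ.1
  have hcv := convex_identSet H.conv H.param hφ.1
  have hcl₀ := isClosed_identSet H.conv H.param H.mem_nbhd_self.1
  have hcv₀ := convex_identSet H.conv H.param H.mem_nbhd_self.1
  constructor
  · rintro θ ⟨hθ, hdist⟩
    by_contra hθ₀
    obtain ⟨ν, y, -, hy, hsep⟩ := exists_separating_direction hcl₀ hcv₀
      (H.reg.nonempty φ₀ H.mem_nbhd_self) hθ₀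
    obtain ⟨R, hR0, hR⟩ := exists_norm_le H.param
    have hνn : ‖(ν : Euc d)‖ = 1 := norm_eq_of_mem_sphere ν
    -- Follow the separating direction from `θ` to the last point of Θ(φ). That point is interior to
    -- Θ, so points just beyond it lie in Θ \ Θ(φ), and membership in the contraction forces a
    -- travelled length of at least ε.
    set A : Set ℝ := {t | 0 ≤ t ∧ θ + t • (ν : Euc d) ∈ M.identSet φ}
    have hAc : IsCompact A := by
      refine isCompact_Icc.of_isClosed_subset (s := Icc 0 (2 * R)) ?_ fun t ht => ⟨ht.1, ?_⟩
      · exact (isClosed_le continuous_const continuous_id).inter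
          (hcl.preimage (f := fun t : ℝ => θ + t • (ν : Euc d)) (by fun_prop))
      · have h1 := norm_sub_le (θ + t • (ν : Euc d)) θ
        rw [add_sub_cancel_left, norm_smul, hνn, mul_one, Real.norm_of_nonneg ht.1] at h1
        have h2 := hR _ ht.2.1
        have h3 := hR _ hθ.1
        linarith
    obtain ⟨t, ht, htmax⟩ := hAc.exists_isGreatest ⟨0, le_rfl, by simpa using hθ⟩
    have htε : ε ≤ t := by
      by_contra hlt
      push Not at hlt
      have hint := H.reg.subset_interior φ hφ ht.2
      have hc : Tendsto (fun s : ℝ => θ + s • (ν : Euc d)) (𝓝 t) (𝓝 (θ + t • (ν : Euc d))) :=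
        Continuous.tendsto (by fun_prop) t
      have h1 : ∀ᶠ s : ℝ in 𝓝[>] t, θ + s • (ν : Euc d) ∈ M.Theta :=
        (hc.eventually (mem_interior_iff_mem_nhds.1 hint)).filter_mono nhdsWithin_le_nhds
      obtain ⟨s, ⟨hsΘ, hs1 : t < s⟩, hs2⟩ :=
        ((h1.and self_mem_nhdsWithin).and
          ((eventually_lt_nhds hlt).filter_mono nhdsWithin_le_nhds)).exists
      have hs0 : 0 ≤ s := ht.1.trans hs1.le
      have hsC : θ + s • (ν : Euc d) ∉ M.identSet φ := fun hmem =>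
        absurd (mem_upperBounds.1 htmax s ⟨hs0, hmem⟩) (not_le.2 hs1)
      have h2 : infEDist θ (M.Theta \ M.identSet φ) ≤ ENNReal.ofReal s := by
        refine (infEDist_le_edist_of_mem (mem_sdiff_of_mem hsΘ hsC)).trans_eq ?_
        rw [edist_dist, dist_eq_norm, sub_add_cancel_left, norm_neg, norm_smul, hνn, mul_one,
          Real.norm_of_nonneg hs0]
      exact absurd ((ENNReal.ofReal_le_ofReal_iff hs0).1 (hdist.trans h2)) (not_le.2 hs2)
    -- Now S_φ(ν) ≥ νᵀθ + ε, and νᵀθ exceeds S_φ₀(ν) strictly by separation.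
    have h1 := H.inner_le_supportFn hφ ν ht.2
    rw [inner_add_right, inner_smul_right, real_inner_self_eq_norm_sq, hνn] at h1
    obtain ⟨w, hw⟩ := H.exists_mem_supportSet H.mem_nbhd_self ν
    have h2 := hsep w hw.1
    rw [← supportFn_eq_of_mem hw] at h2
    have h3 := (abs_le.1 (hle ν)).1
    linarith
  · intro θ hθ
    refine ⟨hθ.1, ?_⟩
    by_cases hmem : θ ∈ M.identSet φ
    · rw [infEDist_zero_of_mem hmem]
      exact zero_le
    obtain ⟨ν, y, hy, -, hsep⟩ := exists_separating_direction hcl hcv (H.reg.nonempty φ hφ) hmem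
    refine (infEDist_le_edist_of_mem hy).trans ?_
    rw [edist_dist, dist_eq_norm]
    refine ENNReal.ofReal_le_ofReal ?_
    obtain ⟨w, hw⟩ := H.exists_mem_supportSet hφ ν
    have h1 := hsep w hw.1
    rw [← supportFn_eq_of_mem hw] at h1
    have h2 := H.inner_le_supportFn H.mem_nbhd_self ν hθ
    have h3 := (abs_le.1 (hle ν)).2
    linarith

end LocalConditions
end MomentModel

/-! ### Lower bound for the posterior quantile -/

lemma abs_measureReal_sub_le_tvDist {α : Type*} [MeasurableSpace α] (μ ν : Measure α)
    [IsProbabilityMeasure μ] [IsProbabilityMeasure ν] {B : Set α} (hB : MeasurableSet B) :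
    |μ.real B - ν.real B| ≤ tvDist μ ν := by
  refine le_ciSup (f := fun B : {B : Set α // MeasurableSet B} => |μ.real B - ν.real B|)
    ⟨1, ?_⟩ ⟨B, hB⟩
  rintro _ ⟨B, rfl⟩
  exact abs_sub_le_of_nonneg_of_le measureReal_nonneg measureReal_le_one measureReal_nonneg
    measureReal_le_one

namespace MomentModel

variable {d p k : ℕ} {M : MomentModel d p k} {φ₀ : Euc p} {Λ : Type*} [MeasurableSpace Λ]

/-- A lower bound for the posterior quantile: by Anderson's inequality, centring the approximating
Gaussian law at a point other than the estimator can only increase the quantile. -/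
lemma le_quantile (hp : M.ParameterSpaces φ₀) {φ : Λ → Euc p} (hφ : Measurable φ) {n : ℕ}
    (hn : 0 < n) {ρ : Measure Λ} [IsProbabilityMeasure ρ] {S : Matrix (Fin p) (Fin p) ℝ}
    {a φhat : Euc p} {G : Seminorm ℝ (Euc p)} (hGc : Continuous G) {τ η R R' r ε κ c : ℝ}
    (hτ : 0 < τ) (hε : 0 ≤ ε)
    (htv : tvDist (ρ.map fun t => √(n : ℝ) • (φ t - φ₀)) (multivariateGaussian a S) ≤ η)
    (ha : ‖a‖ ≤ R) (hhat : ‖√(n : ℝ) • (φhat - φ₀)‖ ≤ R)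
    (hlow : ∀ φ₁ ∈ closedBall φ₀ r, ∀ φ₂ ∈ closedBall φ₀ r,
      G (φ₁ - φ₂) - ε * ‖φ₁ - φ₂‖ ≤ ⨆ ν, |M.supportFn φ₁ ν - M.supportFn φ₂ ν|)
    (hR' : 0 ≤ R') (hr : R' + R ≤ √(n : ℝ) * r) (hκ : ε * (R' + 2 * R) ≤ κ)
    (hF : (multivariateGaussian 0 S).real {x | G x ≤ c}
      + (multivariateGaussian 0 S).real {x | R' < ‖x‖} + 2 * η < 1 - τ) :
    c - κ ≤ M.quantile φ n ρ φhat τ := by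
  have hsn : 0 < √(n : ℝ) := Real.sqrt_pos.2 (by exact_mod_cast hn)
  set s := √(n : ℝ) with hs
  have hmeas : Measurable fun t => s • (φ t - φ₀) := by fun_prop
  have hprob : IsProbabilityMeasure (ρ.map fun t => s • (φ t - φ₀)) :=
    Measure.isProbabilityMeasure_map hmeas.aemeasurable
  have hcomp : ∀ B : Set (Euc p), MeasurableSet B →
      ρ.real ((fun t => s • (φ t - φ₀)) ⁻¹' B) ≤ (multivariateGaussian a S).real B + η := by
    intro B hB
    have h1 := (abs_le.1 (abs_measureReal_sub_le_tvDist (ρ.map fun t => s • (φ t - φ₀))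
      (multivariateGaussian a S) hB)).2
    rw [measureReal_def, Measure.map_apply hmeas hB, ← measureReal_def] at h1
    linarith
  refine le_csInf ?_ fun c₁ (hc₁ : 1 - τ ≤ _) => ?_
  -- Support functions are uniformly bounded, so the set defining the quantile is nonempty and its
  -- infimum is not a default value.
  · obtain ⟨Rθ, hRθ0, hRθ⟩ := LocalConditions.exists_norm_le hp
    refine ⟨s * (2 * Rθ), ?_⟩
    have huniv : {t | M.scaledSupDist n (φ t) φhat ≤ s * (2 * Rθ)} = univ := by
      refine eq_univ_of_forall fun t => ?_
      refine mul_le_mul_of_nonneg_left (Real.iSup_le (fun ν => ?_) (by positivity)) hsn.le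
      have h1 := LocalConditions.abs_supportFn_le hRθ0.le hRθ (φ t) ν
      have h2 := LocalConditions.abs_supportFn_le hRθ0.le hRθ φhat ν
      have := abs_sub (M.supportFn (φ t) ν) (M.supportFn φhat ν)
      linarith
    simp only [mem_ofPred_eq, huniv, probReal_univ]
    linarith
  · by_contra hlt
    push Not at hlt
    have hball : ∀ ψ : Euc p, ‖s • (ψ - φ₀)‖ ≤ R' + R → ψ ∈ closedBall φ₀ r := by
      intro ψ hψ
      rw [norm_smul, Real.norm_of_nonneg hsn.le] at hψ
      rw [mem_closedBall, dist_eq_norm]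
      exact le_of_mul_le_mul_left (hψ.trans hr) hsn
    -- Off the tail event the lower comparison gives G(√n(φ - φ̂)) ≤ c₁ + κ, which is below `c`.
    have hsub : {t | M.scaledSupDist n (φ t) φhat ≤ c₁}
        ⊆ (fun t => s • (φ t - φ₀)) ⁻¹' {x | R' + R < ‖x‖}
          ∪ (fun t => s • (φ t - φ₀)) ⁻¹' {x | G (x - s • (φhat - φ₀)) ≤ c} := by
      intro t (ht : M.scaledSupDist n (φ t) φhat ≤ c₁)
      by_cases hbig : R' + R < ‖s • (φ t - φ₀)‖
      · exact Or.inl hbig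
      refine Or.inr ?_
      push Not at hbig
      change G (s • (φ t - φ₀) - s • (φhat - φ₀)) ≤ c
      have h1 := hlow (φ t) (hball _ hbig) φhat (hball _ (hhat.trans (by linarith)))
      have h2 := mul_le_mul_of_nonneg_left h1 hsn.le
      have h3 : s • (φ t - φ₀) - s • (φhat - φ₀) = s • (φ t - φhat) := by module
      have h4 : G (s • (φ t - φhat)) = s * G (φ t - φhat) := by
        rw [map_smul_eq_mul, Real.norm_of_nonneg hsn.le]
      have h5 : s * ‖φ t - φhat‖ ≤ R' + 2 * R := by
        have h6 := norm_sub_le (s • (φ t - φ₀)) (s • (φhat - φ₀))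
        rw [h3, norm_smul, Real.norm_of_nonneg hsn.le] at h6
        linarith
      have h7 := (mul_le_mul_of_nonneg_left h5 hε).trans hκ
      have h8 : s * ⨆ ν, |M.supportFn (φ t) ν - M.supportFn φhat ν| ≤ c₁ := ht
      rw [h3, h4]
      nlinarith
    -- Each of the two covering events costs one total variation error, whence `2 * η`.
    have h1 := hcomp {x | R' + R < ‖x‖} (isOpen_lt continuous_const continuous_norm).measurableSet
    have h2 := hcomp {x | G (x - s • (φhat - φ₀)) ≤ c}
      (isClosed_le (hGc.comp (continuous_sub_right _)) continuous_const).measurableSet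
    have h3 := multivariateGaussian_norm_gt_le (R := R') S ha
    have h4 := multivariateGaussian_seminorm_sub_le a (s • (φhat - φ₀)) S G hGc c
    have h5 := (measureReal_mono hsub (μ := ρ)).trans (measureReal_union_le _ _)
    linarith

end MomentModel

/-! ### Asymptotic coverage -/

lemma MeasureTheory.TendstoInDistribution.eventually_lt_measureReal {Ω E : Type*}
    [MeasurableSpace Ω] [NormedAddCommGroup E] [MeasurableSpace E] [BorelSpace E]
    {Pr : Measure Ω} [IsProbabilityMeasure Pr] {μ : Measure E} [IsProbabilityMeasure μ]
    {Y : ℕ → Ω → E} (h : TendstoInDistribution Y atTop id (fun _ => Pr) μ) {U : Set E}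
    (hU : IsOpen U) {c : ℝ} (hc : c < μ.real U) : ∀ᶠ n in atTop, c < Pr.real (Y n ⁻¹' U) := by
  rcases lt_or_ge c 0 with hc0 | hc0
  · exact Eventually.of_forall fun n => hc0.trans_le measureReal_nonneg
  have h1 := ProbabilityMeasure.le_liminf_measure_open_of_tendsto h.tendsto hU
  simp only [ProbabilityMeasure.coe_mk, Measure.map_id] at h1
  have h2 : ENNReal.ofReal c < μ U :=
    (ENNReal.ofReal_lt_iff_lt_toReal hc0 (measure_ne_top _ _)).2 hc
  filter_upwards [eventually_lt_of_lt_liminf (h2.trans_le h1)] with n hn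
  rw [Measure.map_apply_of_aemeasurable (h.forall_aemeasurable n) hU.measurableSet] at hn
  exact (ENNReal.ofReal_lt_iff_lt_toReal hc0 (measure_ne_top _ _)).1 hn

theorem mainTheorem3 {d p k : ℕ} {𝒳 Λ Ω : Type*} [MeasurableSpace 𝒳] [MeasurableSpace Λ]
    [MeasurableSpace Ω]
    -- the moment inequality model
    (M : MomentModel d p k)
    -- the Bayesian experiment: sampling laws `P t`, functional `φ`, prior, posteriors
    (P : Kernel Λ 𝒳) [IsMarkovKernel P]
    (φ : Λ → Euc p) (hφ : Measurable φ) (hφ_mem : ∀ t, φ t ∈ M.Phi)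
    (π : Measure Λ) [IsProbabilityMeasure π]
    (post : ∀ n : ℕ, Kernel (Fin n → 𝒳) Λ) [∀ n, IsMarkovKernel (post n)]
    (hpost : ∀ n, IsPosterior P π n (post n))
    -- the truth and the i.i.d. data
    (t₀ : Λ) (φ₀ : Euc p) (hφ₀ : φ t₀ = φ₀)
    (Pr : Measure Ω) [IsProbabilityMeasure Pr]
    (X : ℕ → Ω → 𝒳) (hX : ∀ i, Measurable (X i)) (hX_indep : iIndepFun X Pr)
    (hX_law : ∀ i, Pr.map (X i) = P t₀)
    (D : ∀ n : ℕ, Ω → Fin n → 𝒳) (hD : ∀ n ω i, D n ω i = X i ω)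
    -- conditions on the moment function
    (h_conv : M.ContinuousConvex) (h_param : M.ParameterSpaces φ₀)
    (h_reg : ∀ᶠ n in atTop, M.LocalRegularity φ₀ (logRate n))
    (h_indep : M.IndependentGradients φ₀)
    (h_lin : ∀ᶠ n in atTop, M.SingletonOrLinear φ₀ (logRate n))
    (lam : USphere d → Euc p → Euc k)
    (h_lam : ∀ᶠ n in atTop, ∀ ν, ∀ φ' ∈ M.nbhd φ₀ (logRate n),
      M.IsLagrangeMultiplier ν φ' (lam ν φ'))
    (h_lip : ∀ᶠ n in atTop, M.LipschitzConditions φ₀ lam (logRate n))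
    (h_rate : M.SupportSetRate φ₀ logRate)
    (h_nondeg : M.Nondegenerate φ₀ lam)
    -- posterior concentration
    (h_conc : ∃ C > 0, TendstoInMeasure Pr
      (fun n ω => (post n (D n ω)).real {t | ‖φ t - φ₀‖ ≤ C * logRate n}) atTop (fun _ => 1))
    -- efficient score and information, and the Bernstein--von Mises property of `φ`
    (𝒞 : Set (ℝ → Λ)) (l : 𝒳 → Euc p) (I₀ : Matrix (Fin p) (Fin p) ℝ)
    (h_eff : IsEfficientScore P φ t₀ 𝒞 l I₀)
    (h_bvm : TendstoInMeasure Pr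
      (fun n ω => tvDist ((post n (D n ω)).map fun t => √(n : ℝ) • (φ t - φ₀))
        (multivariateGaussian (scoreAverage l I₀ n (D n ω)) I₀⁻¹)) atTop (fun _ => 0))
    -- the estimator
    (φhat : ∀ n : ℕ, (Fin n → 𝒳) → Euc p) (hφhat : ∀ n, Measurable (φhat n))
    (hφhat_mem : ∀ n x, φhat n x ∈ M.Phi)
    (h_clt : TendstoInDistribution (fun (n : ℕ) ω => √(n : ℝ) • (φhat n (D n ω) - φ₀)) atTop id
      (fun _ => Pr) (multivariateGaussian 0 I₀⁻¹))
    (τ : ℝ) (hτ : τ ∈ Ioo (0 : ℝ) 1) :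
    ∃ Δ : ∀ n : ℕ, (Fin n → 𝒳) → ℝ, (∀ n, Measurable (Δ n)) ∧
      TendstoInMeasure Pr (fun n ω => Δ n (D n ω)) atTop (fun _ => 0) ∧
      ∀ (n : ℕ) (x : Fin n → 𝒳), 1 - τ + Δ n x ≤
        Pr.real {ω |
          M.contraction (M.identSet (φhat n (D n ω)))
              (M.quantile φ n (post n (D n ω)) (φhat n (D n ω)) τ / √(n : ℝ))
            ⊆ M.identSet φ₀ ∧
          M.identSet φ₀ ⊆
            M.envelope (M.identSet (φhat n (D n ω)))
              (M.quantile φ n (post n (D n ω)) (φhat n (D n ω)) τ / √(n : ℝ))} := by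
  obtain rfl : D = fun n ω (i : Fin n) => X i ω := by
    funext n ω i
    exact hD n ω i
  -- One fixed neighbourhood of φ₀ suffices for all later `n`; `N ≥ 2` makes its radius positive.
  obtain ⟨N, ⟨hreg, hlin, hmult, hlip⟩, hN⟩ :=
    ((h_reg.and (h_lin.and (h_lam.and h_lip))).and (eventually_ge_atTop 2)).exists
  have hNpos : 0 < logRate N := by
    have h2 : (1 : ℝ) < N := by exact_mod_cast hN
    exact Real.sqrt_pos.2 (div_pos (Real.log_pos h2) (by linarith))
  have H : M.LocalConditions φ₀ lam (logRate N) :=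
    ⟨hNpos, h_conv, h_param, hreg, h_indep, hlin, hmult, hlip⟩
  obtain ⟨G, hGc, hG0, hG⟩ := H.exists_seminorm h_nondeg
  have hS := h_eff.posDef_inv_information
  set γ := multivariateGaussian (0 : Euc p) I₀⁻¹ with hγ
  set cov : ℕ → ℝ := fun n => Pr.real {ω |
    M.contraction (M.identSet (φhat n fun i : Fin n => X i ω))
        (M.quantile φ n (post n fun i => X i ω) (φhat n fun i => X i ω) τ / √(n : ℝ))
      ⊆ M.identSet φ₀ ∧
    M.identSet φ₀ ⊆ M.envelope (M.identSet (φhat n fun i : Fin n => X i ω))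
      (M.quantile φ n (post n fun i => X i ω) (φhat n fun i => X i ω) τ / √(n : ℝ))} with hcov
  have key : ∀ η > 0, η < 1 - τ → ∀ᶠ n in atTop, 1 - τ - η ≤ cov n := by
    intro η hη hητ
    -- The level `c'` controls the estimator and `c` the quantile. The gap `c - c' = 2κ` pays κ for
    -- making an event open, κ/2 for the expansion of the support function and κ/2 for the quantile
    -- bound.
    obtain ⟨c', hc'⟩ := exists_multivariateGaussian_seminorm_le_eq hS G hGc hG0
      (v := 1 - τ - η / 2) ⟨by linarith, by linarith [hτ.1]⟩
    obtain ⟨c, hc⟩ := exists_multivariateGaussian_seminorm_le_eq hS G hGc hG0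
      (v := 1 - τ - η / 4) ⟨by linarith, by linarith [hτ.1]⟩
    have hcc : c' < c := by
      by_contra hle
      push Not at hle
      have := measureReal_mono (μ := γ) fun x (hx : G x ≤ c) => (hx.trans hle : G x ≤ c')
      have : γ.real {x | G x ≤ c} ≤ γ.real {x | G x ≤ c'} := this
      linarith
    obtain ⟨R', hR'tail, hR'0⟩ := (((tendsto_measureReal_norm_gt γ).eventually_le_const
      (show (0 : ℝ) < η / 16 by positivity)).and (eventually_ge_atTop 0)).exists
    obtain ⟨RΔ, -, hRΔ⟩ := h_eff.exists_forall_measureReal_norm_scoreAverage_le hX hX_indep hX_law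
      (show 0 < η / 16 by positivity)
    -- A common bound for the score average and the estimator; the `+ 1` places the closed ball of
    -- radius `R'` inside the open ball of radius `R`.
    set R := max RΔ (R' + 1)
    have hR0 : 0 < R := lt_of_lt_of_le (by linarith) (le_max_right _ _)
    set κ := (c - c') / 2 with hκ
    have hκ0 : 0 < κ := by simp only [hκ]; linarith
    set ε := κ / 2 / (R' + 2 * R) with hεdef
    have hε : 0 < ε := by positivity
    have hεR : ε * (R' + 2 * R) = κ / 2 := div_mul_cancel₀ _ (by positivity)
    obtain ⟨r₁, hr₁, hup, hlow⟩ := hG ε hε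
    obtain ⟨r₂, hr₂, hr₂s⟩ := H.exists_closedBall_subset
    -- An open set is needed for the portmanteau lower bound.
    set U : Set (Euc p) := {x | G x < c' + κ} ∩ ball 0 R
    have hUo : IsOpen U := (isOpen_lt hGc continuous_const).inter isOpen_ball
    have hUm : 1 - τ - η / 2 - η / 16 ≤ γ.real U := by
      have h1 : {x | G x ≤ c'} ⊆ U ∪ {x | R' < ‖x‖} := by
        intro x (hx : G x ≤ c')
        by_cases hxR : R' < ‖x‖
        · exact Or.inr hxR
        · refine Or.inl ⟨show G x < c' + κ by linarith, ?_⟩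
          push Not at hxR
          rw [mem_ball_zero_iff]
          exact lt_of_lt_of_le (by linarith) (le_max_right _ _)
      have h2 := (measureReal_mono (μ := γ) h1).trans (measureReal_union_le _ _)
      linarith
    have hev1 := h_clt.eventually_lt_measureReal hUo
      (show 1 - τ - η / 2 - η / 8 < γ.real U by linarith)
    have hev2 : ∀ᶠ n in atTop, Pr.real {ω | η / 32 < tvDist
        ((post n fun i : Fin n => X i ω).map fun t => √(n : ℝ) • (φ t - φ₀))
        (multivariateGaussian (scoreAverage l I₀ n fun i : Fin n => X i ω) I₀⁻¹)} ≤ η / 16 := by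
      have h1 := (h_bvm (ENNReal.ofReal (η / 32)) (by positivity)).eventually_le_const
        (show 0 < ENNReal.ofReal (η / 16) by positivity)
      filter_upwards [h1] with n hn
      refine ENNReal.toReal_le_of_le_ofReal (by positivity) ((measure_mono fun ω hω => ?_).trans hn)
      simp only [mem_ofPred_eq] at hω ⊢
      rw [edist_dist, dist_zero_right]
      exact ENNReal.ofReal_le_ofReal (hω.le.trans (le_abs_self _))
    have hsqrt : Tendsto (fun n : ℕ => √(n : ℝ)) atTop atTop :=
      Real.tendsto_sqrt_atTop.comp tendsto_natCast_atTop_atTop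
    have hev3 := hsqrt.eventually_ge_atTop ((R' + R) / min r₁ r₂)
    filter_upwards [hev1, hev2, hev3, eventually_gt_atTop 0] with n h1 h2 h3 hn
    have hmin : 0 < min r₁ r₂ := lt_min hr₁ hr₂
    have hsn : 0 < √(n : ℝ) := Real.sqrt_pos.2 (by exact_mod_cast hn)
    have hRr : R' + R ≤ √(n : ℝ) * min r₁ r₂ := (div_le_iff₀ hmin).1 h3
    -- Coverage holds when the estimator falls in `U`, except on two events of probability at most
    -- η/16 each.
    have hsub : (fun ω => √(n : ℝ) • ((φhat n fun i : Fin n => X i ω) - φ₀)) ⁻¹' U ⊆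
        ({ω | M.contraction (M.identSet (φhat n fun i : Fin n => X i ω))
            (M.quantile φ n (post n fun i => X i ω) (φhat n fun i => X i ω) τ / √(n : ℝ))
          ⊆ M.identSet φ₀ ∧
        M.identSet φ₀ ⊆ M.envelope (M.identSet (φhat n fun i : Fin n => X i ω))
          (M.quantile φ n (post n fun i => X i ω) (φhat n fun i => X i ω) τ / √(n : ℝ))}
          ∪ {ω | η / 32 < tvDist
            ((post n fun i : Fin n => X i ω).map fun t => √(n : ℝ) • (φ t - φ₀))
            (multivariateGaussian (scoreAverage l I₀ n fun i : Fin n => X i ω) I₀⁻¹)})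
          ∪ {ω | RΔ < ‖scoreAverage l I₀ n fun i : Fin n => X i ω‖} := by
      intro ω hω
      by_cases hb1 : RΔ < ‖scoreAverage l I₀ n fun i : Fin n => X i ω‖
      · exact Or.inr hb1
      by_cases hb2 : η / 32 < tvDist
          ((post n fun i : Fin n => X i ω).map fun t => √(n : ℝ) • (φ t - φ₀))
          (multivariateGaussian (scoreAverage l I₀ n fun i : Fin n => X i ω) I₀⁻¹)
      · exact Or.inl (Or.inr hb2)
      refine Or.inl (Or.inl ?_)
      push Not at hb1 hb2
      obtain ⟨hω1, hω2⟩ := hω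
      set φh := φhat n fun i : Fin n => X i ω
      have hω1 : G (√(n : ℝ) • (φh - φ₀)) < c' + κ := hω1
      have hω2 : ‖√(n : ℝ) • (φh - φ₀)‖ < R := by simpa using hω2
      have hnorm : √(n : ℝ) * ‖φh - φ₀‖ < R := by
        rwa [norm_smul, Real.norm_of_nonneg hsn.le] at hω2
      have hball : φh ∈ closedBall φ₀ (min r₁ r₂) := by
        rw [mem_closedBall, dist_eq_norm]
        exact le_of_mul_le_mul_left (by linarith) hsn
      have hq := M.le_quantile (c := c) (κ := κ / 2) (ε := ε) (r := r₁) h_param hφ hn hGc hτ.1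
        hε.le hb2 (hb1.trans (le_max_left _ _)) hω2.le hlow hR'0
        (hRr.trans (mul_le_mul_of_nonneg_left (min_le_left _ _) hsn.le)) hεR.le (by linarith)
      refine H.contraction_subset_and_subset_envelope
        (hr₂s (closedBall_subset_closedBall (min_le_right _ _) hball)) fun ν => ?_
      rw [le_div_iff₀ hsn]
      -- The chain is √n|S_φ₀ - S_φ̂| ≤ G(√n(φ̂ - φ₀)) + κ/2 < c' + κ + κ/2 = c - κ/2 ≤ q_τ.
      have h4 := hup φh (closedBall_subset_closedBall (min_le_left _ _) hball) ν
      have h5 := mul_le_mul_of_nonneg_right h4 hsn.le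
      have h6 : G (√(n : ℝ) • (φh - φ₀)) = √(n : ℝ) * G (φh - φ₀) := by
        rw [map_smul_eq_mul, Real.norm_of_nonneg hsn.le]
      have h7 : ε * (√(n : ℝ) * ‖φh - φ₀‖) ≤ κ / 2 := by
        rw [← hεR]
        exact mul_le_mul_of_nonneg_left (by linarith) hε.le
      have h8 : (G (φh - φ₀) + ε * ‖φh - φ₀‖) * √(n : ℝ)
          = √(n : ℝ) * G (φh - φ₀) + ε * (√(n : ℝ) * ‖φh - φ₀‖) := by ring
      have h9 : c' + κ + κ / 2 = c - κ / 2 := by simp only [hκ]; ring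
      linarith
    have h4 := (measureReal_mono (μ := Pr) hsub).trans (measureReal_union_le _ _)
    have h5 := h4.trans (add_le_add_left (measureReal_union_le _ _) _)
    have h6 := hRΔ n
    linarith
  -- The coverage probability is a number, so the negative part of its deviation from `1 - τ` serves
  -- as a deterministic remainder.
  refine ⟨fun n _ => min 0 (cov n - (1 - τ)), fun n => measurable_const, ?_, fun n x => ?_⟩
  · refine tendstoInMeasure_of_tendsto_ae (fun n => aestronglyMeasurable_const)
      (ae_of_all _ fun ω => ?_)
    have hτ1 := hτ.2
    refine tendsto_order.2 ⟨fun a ha => ?_, fun a ha =>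
      Eventually.of_forall fun n => (min_le_left _ _).trans_lt ha⟩
    have hη : 0 < min (-a / 2) ((1 - τ) / 2) := lt_min (by linarith) (by linarith)
    filter_upwards [key _ hη ((min_le_right _ _).trans_lt (by linarith))] with n hn
    refine lt_min ha ?_
    have := min_le_left (-a / 2) ((1 - τ) / 2)
    linarith
  · have := min_le_right 0 (cov n - (1 - τ))
    linarith
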